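/- Let $\mathcal H=\bigoplus_{n\ge 0}\mathcal H^n$ be a connected graded commutative Hopf algebra over $\mathbb C$ with counit $\varepsilon$ and antipode $S$ (for instance the Hopf algebra of one-particle-irreducible Feynman graphs, graded by loop number). Let $\mathcal A=\mathbb C((z))$ be the algebra of formal Laurent series with poles of finite order, $\mathcal A=\mathcal A_-\oplus\mathcal A_+$ with $\mathcal A_-=z^{-1}\mathbb C[z^{-1}]$ and $\mathcal A_+=\mathbb C[[z]]$. For a commutative $\mathbb C$-algebra $R$ let $G(R)$ be the group of algebra homomorphisms $\mathcal H\to R$ under the convolution product $\star$, with $\psi^{-1}=\psi\circ S$, and let $\mathfrak g(R)$ be the infinitesimal characters. For $\tau\in R$ let $\tau^Y$ be the operator with $(\tau^Yf)(x)=\tau^nf(x)$ for $x\in\mathcal H^n$. Let $\gamma\in G(\mathcal A)$, and let $\gamma_t=t^Y\gamma\in G(\mathcal A[t,t^{-1}])$ be the corresponding section over $B^*=\Delta^*\times\mathbb C^\times$. The pullback of the connection $\omega$ is $$\gamma_t^*\omega=D\gamma_t=\gamma_t^{-1}\star d\gamma_t=a(z,t)\,dz+b(z,t)\,\frac{dt}{t},$$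 with $a(z,t)=\gamma_t^{-1}\star\partial_z\gamma_t$ and $b(z,t)=\gamma_t^{-1}\star t\,\partial_t\gamma_t$. Two pullbacks are equivalent, $\gamma_t'^*\omega\sim\gamma_t^*\omega$, if $\gamma_t'^*\omega=D\psi+\psi^{-1}\star\gamma_t^*\omega\star\psi$ for some $\psi\in G(\mathcal A_+[t,t^{-1}])$. The pullback $\gamma_t^*\omega$ is equisingular if (i) it is $\mathbb C^\times$-equivariant, that is, $a(z,ut)=u^Ya(z,t)$ and $b(z,ut)=u^Yb(z,t)$ for all $u\in\mathbb C^\times$, and (ii) for all $\sigma,\sigma'\in\mathbb C[[z]]^\times$ with $\sigma(0)=\sigma'(0)$ the restrictions to $t=\sigma(z)$ and to $t=\sigma'(z)$ are equivalent, that is, some $\psi\in G(\mathcal A_+)$ satisfies $\gamma_{\sigma'(z)}=\gamma_{\sigma(z)}\star\psi$, and correspondingly $\sigma'^*(\gamma_t^*\omega)=\psi^{-1}\star d\psi+\psi^{-1}\star\sigma^*(\gamma_t^*\omega)\star\psi$. The Birkhoff decomposition $\gamma=\gamma_-^{-1}\star\gamma_+$ has $\gamma_\pm\in G(\mathcal A)$,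 with $\gamma_+$ taking values in $\mathcal A_+$ and $\gamma_-(\ker\varepsilon)\subset\mathcal A_-$; $\gamma_-$ is the counterterm. A change of the renormalization mass by $t=e^s$, $s\in\mathbb C$, replaces $\gamma$ by $t^{zY}\gamma=(e^{sz})^Y\gamma$. For $\gamma\in G(\mathcal A)$ put $$\beta(\gamma)=\frac{d}{dt}\Big|_{t=1}\ \lim_{z\to0}\ \gamma^{-1}\star t^{zY}\gamma ,$$ which is defined when the limit exists for all $t=e^s$. Let $\alpha_{-1}$ be the residue at $z=0$ of $b(z,1)$, and $\mathrm{Ad}(g)\alpha=g\star\alpha\star g^{-1}$. **Proposition.** The following statements are equivalent. 1. $\gamma_t^*\omega$ is equisingular. 2. The counterterm of $t^{zY}\gamma$ does not depend on $t=e^s$. 3. $b(z,1)=\sum_{i\ge-1}\alpha_iz^i$ with $\alpha_i\in\mathfrak g(\mathbb C)$, that is, $b(z,1)$ has at most a simple pole. 4. The residue $\alpha_{-1}$, transported to the counterterm as $\mathrm{Ad}(\gamma_+(0))\alpha_{-1}$, determines the pullback up to equivalence: if $\gamma'\in G(\mathcal A)$ is such that $b_{\gamma'}(z,1)$ has at most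 a simple pole and $\mathrm{Ad}(\gamma'_+(0))\alpha'_{-1}=\mathrm{Ad}(\gamma_+(0))\alpha_{-1}$, then $\gamma_t'^*\omega\sim\gamma_t^*\omega$. Moreover, if they hold, then $\beta(\gamma)$ and $\beta(\gamma_-^{-1})$ are defined, $\alpha_{-1}=\beta(\gamma)$ and $\mathrm{Ad}(\gamma_+(0))\alpha_{-1}=\beta(\gamma_-^{-1})$. -/

import Mathlib

open scoped TensorProduct LaurentPolynomial

noncomputable section

namespace Renorm

/-! ### Connected graded Hopf algebras, characters and the grading action -/

/-- `𝒢` is a connected grading of the Hopf algebra `H`: the coproduct is homogeneous and the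
degree zero part consists of the scalars.  (That the product is homogeneous is the instance
`GradedAlgebra 𝒢`; that the counit and the antipode are homogeneous then follows.) -/
structure IsConnectedGrading {H : Type*} [CommRing H] [HopfAlgebra ℂ H]
    (𝒢 : ℕ → Submodule ℂ H) : Prop where
  comul_mem : ∀ (n : ℕ), ∀ x ∈ 𝒢 n, (Coalgebra.comul x : H ⊗[ℂ] H) ∈
    ⨆ p ∈ Finset.HasAntidiagonal.antidiagonal n,
      LinearMap.range (TensorProduct.map (𝒢 p.1).subtype (𝒢 p.2).subtype)
  zero_eq : 𝒢 0 = 1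

section General

variable {H : Type*} [CommRing H] [HopfAlgebra ℂ H] {S : Type*} [CommRing S] [Algebra ℂ S]

/-- The convolution product of linear maps on `H`. -/
def conv (f g : H →ₗ[ℂ] S) : H →ₗ[ℂ] S :=
  LinearMap.mul' ℂ S ∘ₗ TensorProduct.map f g ∘ₗ Coalgebra.comul

/-- `f ∘ antipode`, the inverse of `f` for the convolution product if `f` is a character. -/
def inv (f : H →ₗ[ℂ] S) : H →ₗ[ℂ] S :=
  f ∘ₗ HopfAlgebra.antipode ℂ

/-- Infinitesimal characters of `H` with values in `S`, the elements of the Lie algebra. -/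
def IsInfinitesimalCharacter (f : H →ₗ[ℂ] S) : Prop :=
  ∀ x y : H, f (x * y) =
    f x * algebraMap ℂ S (Coalgebra.counit y) + algebraMap ℂ S (Coalgebra.counit x) * f y

/-- The action `f ↦ τ ^ Y f` of the grading: a homogeneous `x` of degree `n` is sent to
`τ ^ n * f x`. -/
def twist (𝒢 : ℕ → Submodule ℂ H) [GradedAlgebra 𝒢] (τ : S) (f : H →ₗ[ℂ] S) : H →ₗ[ℂ] S :=
  DirectSum.toModule ℂ ℕ S (fun n => LinearMap.mulLeft ℂ (τ ^ n) ∘ₗ f ∘ₗ (𝒢 n).subtype) ∘ₗ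
    (DirectSum.decomposeLinearEquiv 𝒢).toLinearMap

/-- The logarithmic derivative `f⁻¹ ⋆ d f` for the linear operator `d` on `S`. -/
def logDeriv (d : S →ₗ[ℂ] S) (f : H →ₗ[ℂ] S) : H →ₗ[ℂ] S :=
  conv (inv f) (d ∘ₗ f)

/-- `ψ⁻¹ ⋆ a ⋆ ψ`. -/
def conjBy (ψ a : H →ₗ[ℂ] S) : H →ₗ[ℂ] S :=
  conv (inv ψ) (conv a ψ)

end General

/-! ### Laurent series in `z`, and functions on the base -/

/-- Formal Laurent series in `z` with poles of finite order.  (A definition and not an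
abbreviation, so that its module structure over `ℂ` is the one of the `ℂ`-algebra.) -/
def 𝓐 : Type := LaurentSeries ℂ

instance : CommRing 𝓐 := inferInstanceAs (CommRing (LaurentSeries ℂ))

instance : Algebra ℂ 𝓐 where
  smul r f := (HahnSeries.instSMul : SMul ℂ (LaurentSeries ℂ)).smul r f
  algebraMap := (HahnSeries.C : ℂ →+* LaurentSeries ℂ)
  commutes' _ _ := mul_comm _ _
  smul_def' _ _ := HahnSeries.C_mul_eq_smul.symm

/-- Functions of `(z, t)`: Laurent polynomials in `t` with coefficients in `𝓐`. -/
abbrev 𝓑 : Type := 𝓐[T;T⁻¹]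

/-- The inclusion of power series in `z`. -/
def ofPowerSeries : PowerSeries ℂ →+* 𝓐 := HahnSeries.ofPowerSeries ℤ ℂ

/-- `d/dz` on `𝓐`. -/
def ddz : 𝓐 →ₗ[ℂ] 𝓐 where
  toFun f := LaurentSeries.hasseDeriv ℂ 1 f
  map_add' f g := (LaurentSeries.hasseDeriv ℂ 1).map_add f g
  map_smul' r f := (LaurentSeries.hasseDeriv ℂ 1).map_smul r f

/-- The coefficient of `z ^ n`. -/
def zcoeff (n : ℤ) : 𝓐 →ₗ[ℂ] ℂ where
  toFun f := HahnSeries.coeff f n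
  map_add' _ _ := rfl
  map_smul' _ _ := rfl

/-- `f` has no pole, that is, it belongs to `𝓐₊ = ℂ⟦z⟧`. -/
def IsRegular (f : 𝓐) : Prop := ∀ n : ℤ, n < 0 → zcoeff n f = 0

/-- `f` belongs to `𝓐₋ = z⁻¹ ℂ[z⁻¹]`. -/
def IsPolar (f : 𝓐) : Prop := ∀ n : ℤ, 0 ≤ n → zcoeff n f = 0

/-- The linear operator on `𝓑` given by `c * t ^ n ↦ L n c * t ^ n`. -/
def termwise (L : ℤ → 𝓐 →ₗ[ℂ] 𝓐) : 𝓑 →ₗ[ℂ] 𝓑 where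
  toFun f := f.coeff.sum fun n c => AddMonoidAlgebra.single n (L n c)
  map_add' f g := by
    rw [AddMonoidAlgebra.coeff_add, Finsupp.sum_add_index'] <;> intros <;> simp
  map_smul' r f := by
    rw [AddMonoidAlgebra.coeff_smul, Finsupp.sum_smul_index']
    · simp only [map_smul, RingHom.id_apply, Finsupp.smul_sum, AddMonoidAlgebra.smul_single]
    · simp

/-- `∂/∂z` on `𝓑`. -/
def pdz : 𝓑 →ₗ[ℂ] 𝓑 := termwise fun _ => ddz

/-- `t ∂/∂t` on `𝓑`. -/
def tpdt : 𝓑 →ₗ[ℂ] 𝓑 := termwise fun n => (n : ℂ) • LinearMap.id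

/-- `f(z, t) ↦ f(z, u t)`. -/
def rescale (u : ℂˣ) : 𝓑 →ₗ[ℂ] 𝓑 := termwise fun n => ((u ^ n : ℂˣ) : ℂ) • LinearMap.id

/-- `f(z, t) ↦ f(z, τ(z))`. -/
def subst (τ : 𝓐ˣ) : 𝓑 →ₗ[ℂ] 𝓐 := (LaurentPolynomial.leval 𝓐 τ).restrictScalars ℂ

/-- A section `z ↦ (z, σ(z))` of `B → Δ`, with `σ` regular and nowhere zero, seen in `𝓐`. -/
def sectionUnit (σ : (PowerSeries ℂ)ˣ) : 𝓐ˣ :=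
  Units.map ofPowerSeries.toMonoidHom σ

/-- Multiplication by the logarithmic derivative `τ'(z)/τ(z)`. -/
def mulDlog (τ : 𝓐ˣ) : 𝓐 →ₗ[ℂ] 𝓐 :=
  LinearMap.mulLeft ℂ (ddz (τ : 𝓐) * ((τ⁻¹ : 𝓐ˣ) : 𝓐))

/-- The series `exp (s z)`. -/
def expz (s : ℂ) : 𝓐 :=
  ofPowerSeries (PowerSeries.rescale s (PowerSeries.exp ℂ))

/-! ### The connection and its pullbacks -/

section Connection

variable {H : Type*} [CommRing H] [HopfAlgebra ℂ H]

/-- One-forms `a dz + b dt/t` on `B* = Δ* × ℂˣ` with values in linear maps on `H`. -/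
@[ext] structure OneForm (H : Type*) [CommRing H] [HopfAlgebra ℂ H] where
  a : H →ₗ[ℂ] 𝓑
  b : H →ₗ[ℂ] 𝓑

/-- `D f = f⁻¹ ⋆ d f`, the pullback of the connection along the section `f`. -/
def D (f : H →ₗ[ℂ] 𝓑) : OneForm H := ⟨logDeriv pdz f, logDeriv tpdt f⟩

/-- The gauge transform `D ψ + ψ⁻¹ ⋆ w ⋆ ψ` of `w`. -/
def gauge (ψ : H →ₗ[ℂ] 𝓑) (w : OneForm H) : OneForm H :=
  ⟨(D ψ).a + conjBy ψ w.a, (D ψ).b + conjBy ψ w.b⟩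

/-- `σ^*(a dz + b dt/t) = (a(z, σ(z)) + b(z, σ(z)) σ'(z)/σ(z)) dz`; its coefficient. -/
def OneForm.restrict (σ : (PowerSeries ℂ)ˣ) (w : OneForm H) : H →ₗ[ℂ] 𝓐 :=
  subst (sectionUnit σ) ∘ₗ w.a +
    mulDlog (sectionUnit σ) ∘ₗ subst (sectionUnit σ) ∘ₗ w.b

variable (𝒢 : ℕ → Submodule ℂ H) [GradedAlgebra 𝒢]

/-- The section `γ_t = t ^ Y γ` over `B*`. -/
def gammaT (γ : H →ₗ[ℂ] 𝓐) : H →ₗ[ℂ] 𝓑 :=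
  twist 𝒢 (LaurentPolynomial.T 1 : 𝓑) ((Algebra.linearMap 𝓐 𝓑).restrictScalars ℂ ∘ₗ γ)

/-- `γ_t^* ω = D γ_t = a(z, t) dz + b(z, t) dt/t`. -/
def pullback (γ : H →ₗ[ℂ] 𝓐) : OneForm H := D (gammaT 𝒢 γ)

/-- The coefficient `b(z, 1)` of `dt/t` in `γ_t^* ω`, at `t = 1`. -/
def bComponent (γ : H →ₗ[ℂ] 𝓐) : H →ₗ[ℂ] 𝓐 := subst 1 ∘ₗ (pullback 𝒢 γ).b

/-- Gauge equivalence of the pullbacks `γ_t^* ω` and `γ'_t^* ω` by a section `ψ_t` of the group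
that is regular in `z` and `t`. -/
def PullbackEquiv (γ γ' : H →ₗ[ℂ] 𝓐) : Prop :=
  ∃ ψ : H →ₐ[ℂ] 𝓑, (∀ (x : H) (n : ℤ), IsRegular ((ψ x).coeff n)) ∧
    pullback 𝒢 γ' = gauge ψ.toLinearMap (pullback 𝒢 γ)

/-- Equivalence under the regular gauge group of the restrictions of `γ_t^* ω` to the sections
`σ` and `σ'` of `B → Δ`: one and the same regular `ψ` carries the section `σ^* γ_t` to
`σ'^* γ_t`, and the connection `σ^*(γ_t^* ω)` to `σ'^*(γ_t^* ω)`. -/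
def RestrictionEquiv (γ : H →ₗ[ℂ] 𝓐) (σ σ' : (PowerSeries ℂ)ˣ) : Prop :=
  ∃ ψ : H →ₐ[ℂ] 𝓐, (∀ x : H, IsRegular (ψ x)) ∧
    subst (sectionUnit σ') ∘ₗ gammaT 𝒢 γ =
      conv (subst (sectionUnit σ) ∘ₗ gammaT 𝒢 γ) ψ.toLinearMap ∧
    (pullback 𝒢 γ).restrict σ' =
      logDeriv ddz ψ.toLinearMap + conjBy ψ.toLinearMap ((pullback 𝒢 γ).restrict σ)

/-- `γ_t^* ω` is equisingular: it is equivariant for the action of `ℂˣ`, and its restrictions to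
any two sections of `B → Δ` with the same value at `z = 0` are equivalent. -/
def IsEquisingular (γ : H →ₗ[ℂ] 𝓐) : Prop :=
  (∀ u : ℂˣ,
    rescale u ∘ₗ (pullback 𝒢 γ).a =
      twist 𝒢 (algebraMap ℂ 𝓑 u) (pullback 𝒢 γ).a ∧
    rescale u ∘ₗ (pullback 𝒢 γ).b =
      twist 𝒢 (algebraMap ℂ 𝓑 u) (pullback 𝒢 γ).b) ∧
  ∀ σ σ' : (PowerSeries ℂ)ˣ,
    PowerSeries.constantCoeff (σ : PowerSeries ℂ) =
      PowerSeries.constantCoeff (σ' : PowerSeries ℂ) →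
    RestrictionEquiv 𝒢 γ σ σ'

/-! ### Birkhoff decomposition, counterterms and the `β`-function -/

/-- `γ = γ₋⁻¹ ⋆ γ₊` is the Birkhoff decomposition of `γ`. -/
structure IsBirkhoff (γ : H →ₗ[ℂ] 𝓐) (γm γp : H →ₐ[ℂ] 𝓐) : Prop where
  eq : γ = conv (inv γm.toLinearMap) γp.toLinearMap
  polar : ∀ x : H, (Coalgebra.counit x : ℂ) = 0 → IsPolar (γm x)
  regular : ∀ x : H, IsRegular (γp x)

/-- The change of the renormalization mass by `t = exp s`: the character `t ^ (zY) γ`. -/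
def massFlow (s : ℂ) (γ : H →ₗ[ℂ] 𝓐) : H →ₗ[ℂ] 𝓐 := twist 𝒢 (expz s) γ

/-- The counterterm of `t ^ (zY) γ`, `t = exp s`, is the same for all `s`. -/
def CountertermIndependent (γ : H →ₗ[ℂ] 𝓐) : Prop :=
  ∃ γm : H →ₐ[ℂ] 𝓐, ∀ s : ℂ, ∃ γp : H →ₐ[ℂ] 𝓐, IsBirkhoff (massFlow 𝒢 s γ) γm γp

/-- `b = ∑_{i ≥ -1} α i z ^ i` with `α i` infinitesimal characters over `ℂ`. -/
def AtMostSimplePole (b : H →ₗ[ℂ] 𝓐) : Prop :=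
  ∃ α : ℤ → (H →ₗ[ℂ] ℂ), (∀ i, IsInfinitesimalCharacter (α i)) ∧ (∀ i, i < -1 → α i = 0) ∧
    ∀ (x : H) (i : ℤ), zcoeff i (b x) = α i x

/-- The residue `α₋₁` of `b(z, 1)`. -/
def residue (γ : H →ₗ[ℂ] 𝓐) : H →ₗ[ℂ] ℂ := zcoeff (-1) ∘ₗ bComponent 𝒢 γ

/-- `Ad (γ₊(0)) α = γ₊(0) ⋆ α ⋆ γ₊(0)⁻¹`. -/
def adAtZero (γp : H →ₐ[ℂ] 𝓐) (α : H →ₗ[ℂ] ℂ) : H →ₗ[ℂ] ℂ :=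
  conv (zcoeff 0 ∘ₗ γp.toLinearMap) (conv α (inv (zcoeff 0 ∘ₗ γp.toLinearMap)))

/-- `β` is the `β`-function of `γ`: the limit of `γ⁻¹ ⋆ t ^ (zY) γ` at `z = 0` exists for
all `t = exp s`, and `β` is its derivative at `t = 1`, that is, at `s = 0`. -/
def IsBetaFunction (γ : H →ₗ[ℂ] 𝓐) (β : H →ₗ[ℂ] ℂ) : Prop :=
  (∀ (s : ℂ) (x : H), IsRegular (conv (inv γ) (massFlow 𝒢 s γ) x)) ∧
    ∀ x : H, HasDerivAt (fun s : ℂ => zcoeff 0 (conv (inv γ) (massFlow 𝒢 s γ) x)) (β x) 0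

/-- The residue determines the pullback up to gauge equivalence: every `γ'` whose `b`-component
has at most a simple pole and whose residue agrees with that of `γ`, after both are transported
to the counterterms by `Ad (γ₊(0))` and `Ad (γ'₊(0))`, has an equivalent pullback. -/
def ResidueDetermines (γ : H →ₗ[ℂ] 𝓐) : Prop :=
  ∃ γm γp : H →ₐ[ℂ] 𝓐, IsBirkhoff γ γm γp ∧
    ∀ γ' γ'm γ'p : H →ₐ[ℂ] 𝓐, IsBirkhoff γ'.toLinearMap γ'm γ'p →
      AtMostSimplePole (bComponent 𝒢 γ'.toLinearMap) →
      adAtZero γ'p (residue 𝒢 γ'.toLinearMap) = adAtZero γp (residue 𝒢 γ) →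
      PullbackEquiv 𝒢 γ γ'.toLinearMap

end Connection

end Renorm

end

/-!
Linear maps from `H` to a commutative algebra form a ring under convolution, in which characters
are units, derivations of the target and the grading operator `Y` act as derivations, and each
scaling `τ ^ Y` is an endomorphism. The whole statement is an argument about the single element `b
= γ⁻¹ ⋆ Y γ`, which is `b(z, 1)` (`bComponent_eq`).

*The flow.* The derivative at `s = 0` of `γ⁻¹ ⋆ exp(sz) ^ Y γ` is `z b`
(`hasDerivAt_conv_massFlow`). Conversely the coefficient of `v ^ j` in `γ⁻¹ ⋆ (1 + v) ^ Y γ` is a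
polynomial of degree at most `j` in `b` and its derivatives along `Y`, so that it has a pole of
order at most `j` once `z b` is regular, and `γ⁻¹ ⋆ (1 + z w) ^ Y γ` is then regular
(`isRegular_conv_inv_twist`). Two sections `σ`, `σ'` of the base with `σ(0) = σ'(0)` differ by
such a factor `1 + z w`, and `exp(sz)` is one as well. Hence equisingularity, independence of the
counterterm and a simple pole of `b` all say that these flows are regular, and the residue of `b`
is the `β`-function.

*The residue.* Let `γ = γ₋⁻¹ ⋆ γ₊` and `g = γ₋⁻¹`. Up to regular terms `g⁻¹ ⋆ Y g` is the
conjugate of `b` by `γ₊`; being a pure pole, it equals `β / z` with `β = Ad(γ₊(0)) α₋₁` as soon as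
`b` has a simple pole (`IsBirkhoff.inv_comp_degreeOp`). The equation `Y g = g ⋆ (β / z)`
determines `g` degree by degree, so equal transported residues give equal counterterms and a
regular gauge transformation between the pullbacks. Conversely the equation has a solution in
characters for every `β` (`exists_hom_simplePole`); comparing `γ` with the solution for its own
transported residue shows that its `b` has a simple pole, since regular gauge transformations
preserve this.

*Existence.* Both the Birkhoff decomposition and the solution `g` are fixed points of maps that
only look at lower degrees (`exists_fixedPoint`). That they are multiplicative is an identity
between two linear maps on `H ⊗ H`, proved in the convolution ring of that coalgebra: the quotient
of the two maps is `1`, in the first case because it is `1` modulo both polar and regular maps, in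
the second because it is killed by the total grading operator.
-/

noncomputable section

namespace Renorm

open WithConv TensorProduct

/-! ### Convolution products -/

section Convolution

variable {C : Type*} [AddCommMonoid C] [Module ℂ C] [Coalgebra ℂ C]
  {S : Type*} [CommRing S] [Algebra ℂ S] {S' : Type*} [CommRing S'] [Algebra ℂ S']

theorem comp_convMul_of_algHom (φ : S →ₐ[ℂ] S') (f g : C →ₗ[ℂ] S) :
    φ.toLinearMap ∘ₗ (toConv f * toConv g).ofConv =
      (toConv (φ.toLinearMap ∘ₗ f) * toConv (φ.toLinearMap ∘ₗ g)).ofConv :=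
  LinearMap.algHom_comp_convMul_distrib φ (toConv f) (toConv g)

theorem toConv_comp_convMul_of_derivation {d : S →ₗ[ℂ] S}
    (hd : ∀ a b, d (a * b) = d a * b + a * d b) (f g : C →ₗ[ℂ] S) :
    toConv (d ∘ₗ (toConv f * toConv g).ofConv) =
      toConv (d ∘ₗ f) * toConv g + toConv f * toConv (d ∘ₗ g) := by
  ext x
  simp [(Coalgebra.Repr.arbitrary ℂ x).convMul_apply, hd, Finset.sum_add_distrib]

theorem toConv_comp_convMul_of_linear_right {d : S →ₗ[ℂ] S}
    (hd : ∀ a b, d (a * b) = a * d b) (f g : C →ₗ[ℂ] S) :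
    toConv (d ∘ₗ (toConv f * toConv g).ofConv) = toConv f * toConv (d ∘ₗ g) := by
  ext x
  simp [(Coalgebra.Repr.arbitrary ℂ x).convMul_apply, hd]

theorem toConv_comp_convMul_of_linear_left {d : S →ₗ[ℂ] S}
    (hd : ∀ a b, d (a * b) = d a * b) (f g : C →ₗ[ℂ] S) :
    toConv (d ∘ₗ (toConv f * toConv g).ofConv) = toConv (d ∘ₗ f) * toConv g := by
  ext x
  simp [(Coalgebra.Repr.arbitrary ℂ x).convMul_apply, hd]

theorem convMul_mem {M : NonUnitalSubalgebra ℂ S} {f g : WithConv (C →ₗ[ℂ] S)}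
    (hf : ∀ x, f x ∈ M) (hg : ∀ x, g x ∈ M) (x : C) : (f * g) x ∈ M := by
  rw [(Coalgebra.Repr.arbitrary ℂ x).convMul_apply]
  exact sum_mem fun i _ => mul_mem (hf _) (hg _)

end Convolution

/-! ### The convolution group of characters -/

section Characters
variable {H : Type*} [CommRing H] [HopfAlgebra ℂ H] {S : Type*} [CommRing S] [Algebra ℂ S]

theorem toConv_conv (f g : H →ₗ[ℂ] S) : toConv (conv f g) = toConv f * toConv g := rfl

theorem toConv_inv_mul (f : H →ₐ[ℂ] S) :
    toConv (inv f.toLinearMap) * toConv f.toLinearMap = 1 := by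
  have h := comp_convMul_of_algHom f (HopfAlgebra.antipode ℂ) LinearMap.id
  rw [LinearMap.antipode_mul_id] at h
  refine (WithConv.ext h).symm.trans (WithConv.ext (LinearMap.ext fun x => ?_))
  simp

theorem toConv_mul_inv (f : H →ₐ[ℂ] S) :
    toConv f.toLinearMap * toConv (inv f.toLinearMap) = 1 := by
  have h := comp_convMul_of_algHom f LinearMap.id (HopfAlgebra.antipode ℂ)
  rw [LinearMap.id_mul_antipode] at h
  refine (WithConv.ext h).symm.trans (WithConv.ext (LinearMap.ext fun x => ?_))
  simp

/-- The inverse `f ∘ antipode` of a character, as a character. -/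
def invHom (f : H →ₐ[ℂ] S) : H →ₐ[ℂ] S := f.comp (HopfAlgebra.antipodeAlgHom ℂ H)

theorem toLinearMap_invHom (f : H →ₐ[ℂ] S) : (invHom f).toLinearMap = inv f.toLinearMap := rfl

/-- The convolution product of two characters, as a character. -/
def convHom (f g : H →ₐ[ℂ] S) : H →ₐ[ℂ] S := (toConv f * toConv g).ofConv

theorem toLinearMap_convHom (f g : H →ₐ[ℂ] S) :
    (convHom f g).toLinearMap = conv f.toLinearMap g.toLinearMap := rfl

theorem inv_inv (f : H →ₐ[ℂ] S) : inv (inv f.toLinearMap) = f.toLinearMap := by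
  have h := left_inv_eq_right_inv (toConv_inv_mul (invHom f)) (toConv_inv_mul f)
  exact congrArg ofConv h

end Characters

/-! ### Connected gradings: recursion on the degree and convolution inverses -/

section Grading
variable {H : Type*} [CommRing H] [HopfAlgebra ℂ H] {S : Type*} [CommRing S] [Algebra ℂ S]
  (𝒢 : ℕ → Submodule ℂ H) [GradedAlgebra 𝒢]

theorem linearMap_ext_graded {M : Type*} [AddCommMonoid M] [Module ℂ M] {f g : H →ₗ[ℂ] M}
    (h : ∀ n, ∀ x ∈ 𝒢 n, f x = g x) : f = g := by
  ext x
  induction x using DirectSum.Decomposition.inductionOn 𝒢 with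
  | zero => simp
  | homogeneous m => exact h _ _ m.2
  | add a b ha hb => simp [ha, hb]

/-- The linear map with prescribed values on the homogeneous parts. -/
def gradedLift {M : Type*} [AddCommMonoid M] [Module ℂ M] (F : ℕ → H →ₗ[ℂ] M) : H →ₗ[ℂ] M :=
  DirectSum.toModule ℂ ℕ M (fun n => F n ∘ₗ (𝒢 n).subtype) ∘ₗ
    (DirectSum.decomposeLinearEquiv 𝒢).toLinearMap

variable {𝒢}

theorem gradedLift_apply {M : Type*} [AddCommMonoid M] [Module ℂ M] (F : ℕ → H →ₗ[ℂ] M)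
    {n : ℕ} {x : H} (hx : x ∈ 𝒢 n) : gradedLift 𝒢 F x = F n x := by
  change DirectSum.toModule ℂ ℕ M _ (DirectSum.decompose 𝒢 x) = _
  rw [DirectSum.decompose_of_mem 𝒢 hx, ← DirectSum.lof_eq_of ℂ, DirectSum.toModule_lof]
  rfl

theorem twist_apply (τ : S) (f : H →ₗ[ℂ] S) {n : ℕ} {x : H} (hx : x ∈ 𝒢 n) :
    twist 𝒢 τ f x = τ ^ n * f x :=
  gradedLift_apply (fun n => LinearMap.mulLeft ℂ (τ ^ n) ∘ₗ f) hx

variable (𝒢) in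
/-- The operator acting as the scalar `w n` on the homogeneous part of degree `n`. -/
def weight (w : ℕ → ℂ) : H →ₗ[ℂ] H := gradedLift 𝒢 fun n => w n • LinearMap.id

theorem weight_apply (w : ℕ → ℂ) {n : ℕ} {x : H} (hx : x ∈ 𝒢 n) : weight 𝒢 w x = w n • x := by
  simp [weight, gradedLift_apply _ hx]

/-- A map of maps whose value in degree `n` depends only on its argument in degrees below `n` has
a fixed point. -/
theorem exists_fixedPoint (Φ : (H →ₗ[ℂ] S) → (H →ₗ[ℂ] S))
    (hΦ : ∀ f g n, (∀ m < n, ∀ x ∈ 𝒢 m, f x = g x) → ∀ x ∈ 𝒢 n, Φ f x = Φ g x) :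
    ∃ f, Φ f = f := by
  have stable : ∀ n k l, n < k → n < l → ∀ x ∈ 𝒢 n, Φ^[k] 0 x = Φ^[l] 0 x := by
    intro n
    induction n using Nat.strong_induction_on with
    | _ n ih =>
      intro k l hk hl x hx
      obtain ⟨k, rfl⟩ := Nat.exists_eq_succ_of_ne_zero (by omega : k ≠ 0)
      obtain ⟨l, rfl⟩ := Nat.exists_eq_succ_of_ne_zero (by omega : l ≠ 0)
      simp only [Nat.succ_eq_add_one, Function.iterate_succ', Function.comp_apply]
      exact hΦ _ _ n (fun m hm => ih m hm k l (by omega) (by omega)) x hx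
  refine ⟨gradedLift 𝒢 fun n => Φ^[n + 1] 0, linearMap_ext_graded 𝒢 fun n x hx => ?_⟩
  rw [gradedLift_apply _ hx, ← stable n (n + 1 + 1) (n + 1) (by omega) (by omega) x hx,
    Function.iterate_succ', Function.comp_apply]
  refine hΦ _ _ n (fun m hm y hy => ?_) x hx
  rw [gradedLift_apply _ hy]
  exact stable m _ _ (by omega) (by omega) y hy

namespace IsConnectedGrading
variable (h𝒢 : IsConnectedGrading 𝒢)
include h𝒢

omit [GradedAlgebra 𝒢] in
/-- Properties of the coproduct of a homogeneous element are checked on tensors of homogeneous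
elements of complementary degrees. -/
theorem map_comul_mem {M : Type*} [AddCommGroup M] [Module ℂ M] (Φ : H ⊗[ℂ] H →ₗ[ℂ] M)
    (N : Submodule ℂ M) {n : ℕ}
    (h : ∀ p q, p + q = n → ∀ a ∈ 𝒢 p, ∀ b ∈ 𝒢 q, Φ (a ⊗ₜ b) ∈ N) {x : H} (hx : x ∈ 𝒢 n) :
    Φ (Coalgebra.comul x) ∈ N := by
  suffices H : (⨆ p ∈ Finset.HasAntidiagonal.antidiagonal n,
      LinearMap.range (TensorProduct.map (𝒢 p.1).subtype (𝒢 p.2).subtype)) ≤ N.comap Φ from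
    H (h𝒢.comul_mem n x hx)
  refine iSup₂_le fun p hp => ?_
  rintro _ ⟨t, rfl⟩
  induction t using TensorProduct.induction_on with
  | zero => simp
  | tmul a b => exact h p.1 p.2 (by simpa using hp) a a.2 b b.2
  | add a b ha hb => rw [map_add]; exact add_mem ha hb

omit [GradedAlgebra 𝒢] in
theorem map_comul_eq {M : Type*} [AddCommGroup M] [Module ℂ M] {Φ Ψ : H ⊗[ℂ] H →ₗ[ℂ] M} {n : ℕ}
    (h : ∀ p q, p + q = n → ∀ a ∈ 𝒢 p, ∀ b ∈ 𝒢 q, Φ (a ⊗ₜ b) = Ψ (a ⊗ₜ b)) {x : H}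
    (hx : x ∈ 𝒢 n) : Φ (Coalgebra.comul x) = Ψ (Coalgebra.comul x) := by
  have := h𝒢.map_comul_mem (Φ - Ψ) ⊥ (n := n)
    (fun p q hpq a ha b hb => by simp [h p q hpq a ha b hb]) hx
  simpa [sub_eq_zero] using this

omit [GradedAlgebra 𝒢] in
theorem convMul_apply_mem {f g : WithConv (H →ₗ[ℂ] S)} {N : Submodule ℂ S} {n : ℕ}
    (h : ∀ p q, p + q = n → ∀ a ∈ 𝒢 p, ∀ b ∈ 𝒢 q, f a * g b ∈ N) {x : H} (hx : x ∈ 𝒢 n) :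
    (f * g) x ∈ N :=
  h𝒢.map_comul_mem (LinearMap.mul' ℂ S ∘ₗ map f.ofConv g.ofConv) N
    (fun p q hpq a ha b hb => by simpa using h p q hpq a ha b hb) hx

omit [GradedAlgebra 𝒢] in
theorem convMul_apply_congr {f g f' g' : WithConv (H →ₗ[ℂ] S)} {n : ℕ}
    (h : ∀ p q, p + q = n → ∀ a ∈ 𝒢 p, ∀ b ∈ 𝒢 q, f a * g b = f' a * g' b) {x : H}
    (hx : x ∈ 𝒢 n) : (f * g) x = (f' * g') x :=
  h𝒢.map_comul_eq (Φ := LinearMap.mul' ℂ S ∘ₗ map f.ofConv g.ofConv)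
    (Ψ := LinearMap.mul' ℂ S ∘ₗ map f'.ofConv g'.ofConv)
    (fun p q hpq a ha b hb => by simpa using h p q hpq a ha b hb) hx

/-- The scalar valued map `x ↦ ε x` for `x` of degree zero, `x ↦ 0` in positive degree, is a right
unit for the convolution product by homogeneity of the coproduct, hence it is the counit. -/
theorem counit_eq_zero {n : ℕ} (hn : n ≠ 0) {x : H} (hx : x ∈ 𝒢 n) :
    (Coalgebra.counit x : ℂ) = 0 := by
  let e : H →ₗ[ℂ] H := Algebra.linearMap ℂ H ∘ₗ Coalgebra.counit ∘ₗ
    weight 𝒢 (fun n => if n = 0 then 1 else 0)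
  have key : toConv (LinearMap.id : H →ₗ[ℂ] H) * toConv e = toConv LinearMap.id := by
    apply WithConv.ext
    refine linearMap_ext_graded 𝒢 fun m y hy => ?_
    let π := weight 𝒢 (fun k => if k = m then 1 else 0)
    have h1 : y = π ((toConv (LinearMap.id : H →ₗ[ℂ] H) * 1) y) := by
      rw [mul_one]; simp [π, weight_apply _ hy]
    conv_rhs => simp only [LinearMap.id_coe, id]; rw [h1]
    refine h𝒢.map_comul_eq (Φ := LinearMap.mul' ℂ H ∘ₗ map LinearMap.id e)
      (Ψ := π ∘ₗ LinearMap.mul' ℂ H ∘ₗ map LinearMap.id (Algebra.linearMap ℂ H ∘ₗ Coalgebra.counit))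
      (fun p q hpq a ha b hb => ?_) hy
    rcases eq_or_ne q 0 with rfl | hq
    · obtain rfl : p = m := by omega
      simp [e, π, weight_apply _ hb, ← Algebra.commutes, ← Algebra.smul_def, weight_apply _ ha]
    · have : p ≠ m := by omega
      simp [e, π, weight_apply _ hb, hq, ← Algebra.commutes, ← Algebra.smul_def,
        weight_apply _ ha, this]
  have he : toConv e = 1 := by
    have := congrArg (toConv (HopfAlgebra.antipode ℂ (A := H)) * ·) key
    simpa only [← mul_assoc, LinearMap.antipode_mul_id, one_mul] using this
  have := congrArg (fun f : WithConv (H →ₗ[ℂ] H) => (Coalgebra.counit (f x) : ℂ)) he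
  simpa [e, weight_apply _ hx, hn] using this.symm

omit [GradedAlgebra 𝒢] in
theorem eq_algebraMap_counit {x : H} (hx : x ∈ 𝒢 0) :
    x = algebraMap ℂ H (Coalgebra.counit x) := by
  rw [h𝒢.zero_eq, Submodule.mem_one] at hx
  obtain ⟨c, rfl⟩ := hx
  simp

theorem one_apply_of_ne {n : ℕ} (hn : n ≠ 0) {x : H} (hx : x ∈ 𝒢 n) :
    (1 : WithConv (H →ₗ[ℂ] S)) x = 0 := by
  simp [h𝒢.counit_eq_zero hn hx]

omit [GradedAlgebra 𝒢] in
theorem apply_of_mem_zero {f : H →ₗ[ℂ] S} (hf : f 1 = 1) {x : H} (hx : x ∈ 𝒢 0) :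
    f x = (1 : WithConv (H →ₗ[ℂ] S)) x := by
  rw [h𝒢.eq_algebraMap_counit hx, Algebra.algebraMap_eq_smul_one, map_smul, hf]
  simp [Algebra.algebraMap_eq_smul_one]

omit [GradedAlgebra 𝒢] in
/-- `f ⋆ h` in degree `n` depends only on `f` in degrees below `n` if `h` kills scalars. -/
theorem convMul_apply_congr_of_lt {f f' h : WithConv (H →ₗ[ℂ] S)} (hh : ∀ x ∈ 𝒢 0, h x = 0) {n : ℕ}
    (hf : ∀ m < n, ∀ x ∈ 𝒢 m, f x = f' x) {x : H} (hx : x ∈ 𝒢 n) : (f * h) x = (f' * h) x := by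
  refine h𝒢.convMul_apply_congr (fun p q hpq a ha b hb => ?_) hx
  rcases eq_or_ne q 0 with rfl | hq
  · simp [hh b hb]
  · rw [hf p (by omega) a ha]

omit [GradedAlgebra 𝒢] in
theorem sub_one_apply_of_mem_zero {f : WithConv (H →ₗ[ℂ] S)} (hf : f 1 = 1) {x : H} (hx : x ∈ 𝒢 0) :
    (f - 1) x = 0 := by
  have := h𝒢.apply_of_mem_zero (f := f.ofConv) hf hx
  simpa [sub_eq_zero] using this

/-- The left inverse is the fixed point of `g ↦ 1 - g ⋆ (f - 1)`. -/
theorem exists_left_inverse {f : WithConv (H →ₗ[ℂ] S)} (hf : f 1 = 1) :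
    ∃ g : WithConv (H →ₗ[ℂ] S), g 1 = 1 ∧ g * f = 1 := by
  obtain ⟨g, hg⟩ := exists_fixedPoint (𝒢 := 𝒢) (S := S)
    (fun g => (1 - toConv g * (f - 1)).ofConv) (by
      intro g g' n h x hx
      have := h𝒢.convMul_apply_congr_of_lt (f := toConv g) (f' := toConv g')
        (fun x hx => h𝒢.sub_one_apply_of_mem_zero hf hx) h hx
      simpa using this)
  have h2 : toConv g = 1 - toConv g * (f - 1) := WithConv.ext hg.symm
  refine ⟨toConv g, ?_, ?_⟩
  · have h3 : (toConv g * (f - 1)) (1 : H) = 0 := by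
      simp [Algebra.TensorProduct.one_def, hf]
    rw [h2]
    simpa using h3
  · rw [mul_sub, mul_one] at h2
    have := congrArg (fun t => toConv g * f + t - toConv g) h2
    simp only [add_sub_cancel_right] at this
    rw [this]; abel

/-- A linear map sending `1` to `1` is invertible for the convolution product. -/
theorem exists_inverse {f : WithConv (H →ₗ[ℂ] S)} (hf : f 1 = 1) :
    ∃ g : WithConv (H →ₗ[ℂ] S), g 1 = 1 ∧ g * f = 1 ∧ f * g = 1 := by
  obtain ⟨g, hg, hgf⟩ := h𝒢.exists_left_inverse hf
  obtain ⟨k, -, hk⟩ := h𝒢.exists_left_inverse hg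
  have : k = f := left_inv_eq_right_inv hk hgf
  exact ⟨g, hg, hgf, this ▸ hk⟩

/-- If `f - 1` takes values in a subalgebra without unit, then so does `f⁻¹ - 1`. -/
theorem inverse_sub_one_mem {M : NonUnitalSubalgebra ℂ S} {f g : WithConv (H →ₗ[ℂ] S)}
    (hf : f 1 = 1) (hgf : g * f = 1) (hM : ∀ x, (f - 1) x ∈ M) (x : H) :
    (g - 1) x ∈ M := by
  have h2 : g - 1 = -((g - 1) * (f - 1)) - (f - 1) := by
    rw [sub_mul, mul_sub, hgf]; noncomm_ring
  have key : ∀ n, ∀ x ∈ 𝒢 n, (g - 1) x ∈ M.toSubmodule := by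
    intro n
    induction n using Nat.strong_induction_on with
    | _ n ih =>
      intro x hx
      rw [h2]
      refine sub_mem (neg_mem ?_) (hM x)
      refine h𝒢.convMul_apply_mem (fun p q hpq a ha b hb => ?_) hx
      rcases eq_or_ne q 0 with rfl | hq
      · rw [h𝒢.sub_one_apply_of_mem_zero hf hb, mul_zero]; exact zero_mem _
      · exact M.mul_mem (ih p (by omega) a ha) (hM b)
  induction x using DirectSum.Decomposition.inductionOn 𝒢 with
  | zero => rw [map_zero]; exact zero_mem _
  | homogeneous m => exact key _ _ m.2
  | add a b ha hb => rw [map_add]; exact add_mem ha hb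

end IsConnectedGrading
end Grading

/-! ### The grading operator and the action of scalars -/

section Grading
variable {H : Type*} [CommRing H] [HopfAlgebra ℂ H] {S : Type*} [CommRing S] [Algebra ℂ S]
  (𝒢 : ℕ → Submodule ℂ H) [GradedAlgebra 𝒢]

/-- The grading operator `Y`, multiplication by `n` in degree `n`. -/
def degreeOp : H →ₗ[ℂ] H := weight 𝒢 fun n => (n : ℂ)

variable {𝒢}

theorem degreeOp_apply {n : ℕ} {x : H} (hx : x ∈ 𝒢 n) : degreeOp 𝒢 x = (n : ℂ) • x :=
  weight_apply _ hx

theorem degreeOp_mul (x y : H) :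
    degreeOp 𝒢 (x * y) = degreeOp 𝒢 x * y + x * degreeOp 𝒢 y := by
  induction x using DirectSum.Decomposition.inductionOn 𝒢 with
  | zero => simp
  | add a b ha hb => simp only [add_mul, map_add, ha, hb]; ring
  | homogeneous a =>
    induction y using DirectSum.Decomposition.inductionOn 𝒢 with
    | zero => simp
    | add c d hc hd => simp only [mul_add, map_add, hc, hd]; ring
    | homogeneous b =>
      rw [degreeOp_apply a.2, degreeOp_apply b.2, degreeOp_apply (SetLike.mul_mem_graded a.2 b.2)]
      simp only [Nat.cast_add, add_smul, smul_mul_assoc, mul_smul_comm]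

theorem twist_twist (τ σ : S) (f : H →ₗ[ℂ] S) :
    twist 𝒢 τ (twist 𝒢 σ f) = twist 𝒢 (τ * σ) f :=
  linearMap_ext_graded 𝒢 fun n x hx => by simp [twist_apply _ _ hx, mul_pow, mul_assoc]

theorem twist_one_left (f : H →ₗ[ℂ] S) : twist 𝒢 1 f = f :=
  linearMap_ext_graded 𝒢 fun n x hx => by simp [twist_apply _ _ hx]

theorem twist_mul (τ : S) (f : H →ₐ[ℂ] S) (x y : H) :
    twist 𝒢 τ f.toLinearMap (x * y) = twist 𝒢 τ f.toLinearMap x * twist 𝒢 τ f.toLinearMap y := by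
  induction x using DirectSum.Decomposition.inductionOn 𝒢 with
  | zero => simp
  | add a b ha hb => simp only [add_mul, map_add, ha, hb]
  | homogeneous a =>
    induction y using DirectSum.Decomposition.inductionOn 𝒢 with
    | zero => simp
    | add c d hc hd => simp only [mul_add, map_add, hc, hd]
    | homogeneous b =>
      rw [twist_apply _ _ a.2, twist_apply _ _ b.2,
        twist_apply _ _ (SetLike.mul_mem_graded a.2 b.2)]
      simp only [AlgHom.toLinearMap_apply, map_mul, pow_add]
      ring

variable (𝒢) in
/-- `τ ^ Y f` as a character. -/
def twistHom (τ : S) (f : H →ₐ[ℂ] S) : H →ₐ[ℂ] S :=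
  AlgHom.ofLinearMap (twist 𝒢 τ f.toLinearMap)
    (by rw [twist_apply _ _ (SetLike.GradedOne.one_mem : (1 : H) ∈ 𝒢 0)]; simp)
    (twist_mul τ f)

theorem toLinearMap_twistHom (τ : S) (f : H →ₐ[ℂ] S) :
    (twistHom 𝒢 τ f).toLinearMap = twist 𝒢 τ f.toLinearMap := rfl

theorem twist_mem {M : Submodule ℂ S} {τ : S} {f : H →ₗ[ℂ] S}
    (h : ∀ n x, τ ^ n * f x ∈ M) (x : H) : twist 𝒢 τ f x ∈ M := by
  induction x using DirectSum.Decomposition.inductionOn 𝒢 with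
  | zero => simp
  | homogeneous a => rw [twist_apply _ _ a.2]; exact h _ _
  | add a b ha hb => rw [map_add]; exact add_mem ha hb

namespace IsConnectedGrading
variable (h𝒢 : IsConnectedGrading 𝒢)
include h𝒢

theorem twist_convMul (τ : S) (f g : H →ₗ[ℂ] S) :
    toConv (twist 𝒢 τ (toConv f * toConv g).ofConv) =
      toConv (twist 𝒢 τ f) * toConv (twist 𝒢 τ g) := by
  refine WithConv.ext (linearMap_ext_graded 𝒢 fun n x hx => ?_)
  rw [WithConv.ofConv_toConv, twist_apply _ _ hx]
  refine h𝒢.map_comul_eq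
    (Φ := LinearMap.mulLeft ℂ (τ ^ n) ∘ₗ LinearMap.mul' ℂ S ∘ₗ map f g)
    (Ψ := LinearMap.mul' ℂ S ∘ₗ map (twist 𝒢 τ f) (twist 𝒢 τ g))
    (fun p q hpq a ha b hb => ?_) hx
  simp only [LinearMap.comp_apply, map_tmul, LinearMap.mul'_apply, LinearMap.mulLeft_apply,
    twist_apply _ _ ha, twist_apply _ _ hb, ← hpq, pow_add]
  ring

theorem twist_one (τ : S) : twist 𝒢 τ (1 : WithConv (H →ₗ[ℂ] S)).ofConv =
    (1 : WithConv (H →ₗ[ℂ] S)).ofConv := by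
  refine linearMap_ext_graded 𝒢 fun n x hx => ?_
  rw [twist_apply _ _ hx]
  rcases eq_or_ne n 0 with rfl | hn
  · simp
  · rw [h𝒢.one_apply_of_ne hn hx, mul_zero]

theorem twist_inv (τ : S) (f : H →ₐ[ℂ] S) :
    twist 𝒢 τ (inv f.toLinearMap) = inv (twist 𝒢 τ f.toLinearMap) := by
  have h := h𝒢.twist_convMul τ (inv f.toLinearMap) f.toLinearMap
  rw [toConv_inv_mul, h𝒢.twist_one] at h
  exact congrArg ofConv (left_inv_eq_right_inv h.symm (toConv_mul_inv (twistHom 𝒢 τ f)))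

/-- The grading operator is a coderivation. -/
theorem comul_degreeOp :
    Coalgebra.comul ∘ₗ degreeOp 𝒢 =
      (map (degreeOp 𝒢) LinearMap.id + map LinearMap.id (degreeOp 𝒢)) ∘ₗ
        (Coalgebra.comul : H →ₗ[ℂ] H ⊗[ℂ] H) := by
  refine linearMap_ext_graded 𝒢 fun n x hx => ?_
  rw [LinearMap.comp_apply, degreeOp_apply hx, map_smul]
  refine h𝒢.map_comul_eq (Φ := (n : ℂ) • LinearMap.id)
    (Ψ := map (degreeOp 𝒢) LinearMap.id + map LinearMap.id (degreeOp 𝒢))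
    (fun p q hpq a ha b hb => ?_) hx
  simp [degreeOp_apply ha, degreeOp_apply hb, ← hpq, add_smul, TensorProduct.smul_tmul']

end IsConnectedGrading
end Grading

section Coderivation
variable {C : Type*} [AddCommMonoid C] [Module ℂ C] [Coalgebra ℂ C]
  {S : Type*} [CommRing S] [Algebra ℂ S]

/-- Composition with a coderivation is a derivation of the convolution product. -/
theorem convMul_comp_coderivation {N : C →ₗ[ℂ] C}
    (hN : Coalgebra.comul ∘ₗ N =
      (map N LinearMap.id + map LinearMap.id N) ∘ₗ Coalgebra.comul) (f g : WithConv (C →ₗ[ℂ] S)) :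
    toConv ((f * g).ofConv ∘ₗ N) = toConv (f.ofConv ∘ₗ N) * g + f * toConv (g.ofConv ∘ₗ N) := by
  apply WithConv.ext
  simp only [LinearMap.convMul_def, ofConv_add, LinearMap.comp_assoc, hN]
  simp only [LinearMap.add_comp, LinearMap.comp_add, ← LinearMap.comp_assoc, ← map_comp]
  simp only [LinearMap.comp_assoc, LinearMap.comp_id]

/-- The sum of the two actions of a coderivation is a coderivation of the tensor square. -/
theorem comul_tensor_coderivation {N : C →ₗ[ℂ] C}
    (hN : Coalgebra.comul ∘ₗ N =
      (map N LinearMap.id + map LinearMap.id N) ∘ₗ Coalgebra.comul) :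
    Coalgebra.comul ∘ₗ (map N LinearMap.id + map LinearMap.id N : C ⊗[ℂ] C →ₗ[ℂ] C ⊗[ℂ] C) =
      (map (map N LinearMap.id + map LinearMap.id N) LinearMap.id +
        map LinearMap.id (map N LinearMap.id + map LinearMap.id N)) ∘ₗ Coalgebra.comul := by
  ext x y
  have hx : Coalgebra.comul (N x) = _ := LinearMap.congr_fun hN x
  have hy : Coalgebra.comul (N y) = _ := LinearMap.congr_fun hN y
  let N' := map N LinearMap.id + map LinearMap.id N
  -- the middle exchange of the fourfold tensor product intertwines the two actions
  have key : (TensorProduct.tensorTensorTensorComm ℂ C C C C).toLinearMap ∘ₗ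
      (map N' LinearMap.id + map LinearMap.id N') =
      (map N' LinearMap.id + map LinearMap.id N') ∘ₗ
        (TensorProduct.tensorTensorTensorComm ℂ C C C C).toLinearMap := by
    ext a b c d
    simp [N', add_tmul, tmul_add]
    abel
  have := LinearMap.congr_fun key (Coalgebra.comul x ⊗ₜ Coalgebra.comul y)
  simp only [LinearMap.comp_apply, LinearMap.add_apply, map_tmul, LinearMap.id_apply, N',
    map_add] at this hx hy
  simp only [AlgebraTensorModule.curry_apply, LinearMap.restrictScalars_self, curry_apply,
    LinearMap.comp_apply, LinearMap.add_apply, map_tmul, LinearMap.id_apply, map_add,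
    TensorProduct.comul_tmul, hx, hy]
  simpa [AlgebraTensorModule.tensorTensorTensorComm_eq] using this

end Coderivation

/-! ### Multiplicativity as an identity in the convolution algebra of the tensor square -/

section TensorSquare
variable {H : Type*} [CommRing H] [HopfAlgebra ℂ H] {S : Type*} [CommRing S] [Algebra ℂ S]

/-- The map `x ⊗ y ↦ f x * f y`. -/
def tensorSq (f : WithConv (H →ₗ[ℂ] S)) : WithConv (H ⊗[ℂ] H →ₗ[ℂ] S) :=
  toConv (LinearMap.mul' ℂ S ∘ₗ map f.ofConv f.ofConv)

/-- The map `x ⊗ y ↦ f (x * y)`. -/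
def compMul (f : WithConv (H →ₗ[ℂ] S)) : WithConv (H ⊗[ℂ] H →ₗ[ℂ] S) :=
  toConv (f.ofConv ∘ₗ LinearMap.mul' ℂ H)

theorem mul'_map_convMul (f f' g g' : WithConv (H →ₗ[ℂ] S)) :
    toConv (LinearMap.mul' ℂ S ∘ₗ map (f * f').ofConv (g * g').ofConv) =
      toConv (LinearMap.mul' ℂ S ∘ₗ map f.ofConv g.ofConv) *
        toConv (LinearMap.mul' ℂ S ∘ₗ map f'.ofConv g'.ofConv) := by
  have h := comp_convMul_of_algHom (Algebra.TensorProduct.lmul' ℂ (S := S))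
    (map f.ofConv g.ofConv) (map f'.ofConv g'.ofConv)
  rw [TensorProduct.map_convMul_map] at h
  exact WithConv.ext h

theorem tensorSq_mul (f g : WithConv (H →ₗ[ℂ] S)) :
    tensorSq (f * g) = tensorSq f * tensorSq g := mul'_map_convMul f g f g

theorem compMul_mul (f g : WithConv (H →ₗ[ℂ] S)) :
    compMul (f * g) = compMul f * compMul g :=
  WithConv.ext (LinearMap.convMul_comp_coalgHom_distrib f g (Bialgebra.mulCoalgHom ℂ H))

theorem tensorSq_one : tensorSq (1 : WithConv (H →ₗ[ℂ] S)) = 1 := by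
  apply WithConv.ext
  ext x y
  simp [tensorSq, mul_comm]

theorem compMul_one : compMul (1 : WithConv (H →ₗ[ℂ] S)) = 1 := by
  apply WithConv.ext
  ext x y
  simp [compMul, mul_comm]

/-- A linear map sending `1` to `1` whose two extensions to the tensor square agree is a
character. -/
def homOfTensorSq (f : WithConv (H →ₗ[ℂ] S)) (h1 : f 1 = 1) (h : compMul f = tensorSq f) :
    H →ₐ[ℂ] S :=
  AlgHom.ofLinearMap f.ofConv h1 fun x y => by
    have := congrArg (fun F : WithConv (H ⊗[ℂ] H →ₗ[ℂ] S) => F (x ⊗ₜ y)) h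
    simpa [compMul, tensorSq] using this

theorem tensorSq_toLinearMap (f : H →ₐ[ℂ] S) :
    tensorSq (toConv f.toLinearMap) = compMul (toConv f.toLinearMap) := by
  apply WithConv.ext
  ext x y
  simp [tensorSq, compMul]

theorem tensorSq_sub_one_mem {M : NonUnitalSubalgebra ℂ S} {f : WithConv (H →ₗ[ℂ] S)}
    (hf : ∀ x, (f - 1) x ∈ M) (t : H ⊗[ℂ] H) : (tensorSq f - 1) t ∈ M := by
  induction t using TensorProduct.induction_on with
  | zero => rw [map_zero]; exact zero_mem _
  | add a b ha hb => rw [map_add]; exact add_mem ha hb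
  | tmul x y =>
    have e : (tensorSq f - 1) (x ⊗ₜ y) = (f - 1) x * (f - 1) y +
        (Coalgebra.counit y : ℂ) • (f - 1) x + (Coalgebra.counit x : ℂ) • (f - 1) y := by
      simp [tensorSq, Algebra.smul_def]
      ring
    rw [e]
    exact add_mem (add_mem (mul_mem (hf x) (hf y)) (SMulMemClass.smul_mem _ (hf x)))
      (SMulMemClass.smul_mem _ (hf y))

theorem compMul_sub_one_mem {M : NonUnitalSubalgebra ℂ S} {f : WithConv (H →ₗ[ℂ] S)}
    (hf : ∀ x, (f - 1) x ∈ M) (t : H ⊗[ℂ] H) : (compMul f - 1) t ∈ M := by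
  rw [← compMul_one]
  exact hf (LinearMap.mul' ℂ H t)

theorem mul_sub_one_mem {C : Type*} [AddCommMonoid C] [Module ℂ C] [Coalgebra ℂ C]
    {M : NonUnitalSubalgebra ℂ S} {f g : WithConv (C →ₗ[ℂ] S)}
    (hf : ∀ x, (f - 1) x ∈ M) (hg : ∀ x, (g - 1) x ∈ M) (x : C) : (f * g - 1) x ∈ M := by
  have : f * g - 1 = (f - 1) * (g - 1) + (f - 1) + (g - 1) := by noncomm_ring
  rw [this]
  exact add_mem (add_mem (convMul_mem hf hg x) (hf x)) (hg x)

variable {𝒢 : ℕ → Submodule ℂ H} [GradedAlgebra 𝒢]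

theorem convMul_apply_one {C : Type*} [CommRing C] [Bialgebra ℂ C]
    (f g : WithConv (C →ₗ[ℂ] S)) : (f * g) 1 = f 1 * g 1 := by
  simp [Algebra.TensorProduct.one_def]

theorem compMul_apply_one (f : WithConv (H →ₗ[ℂ] S)) : compMul f 1 = f 1 := by
  simp [compMul, Algebra.TensorProduct.one_def]

theorem tensorSq_apply_one (f : WithConv (H →ₗ[ℂ] S)) : tensorSq f 1 = f 1 * f 1 := by
  simp [tensorSq, Algebra.TensorProduct.one_def]

theorem eq_zero_of_mul_add_eq {R : Type*} [Ring R] {d V T T' b : R}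
    (h : d * T + V * (T * b) = V * T * b) (hT : T * T' = 1) : d = 0 := by
  have h2 : d * T = 0 := by
    rw [mul_assoc] at h
    exact add_eq_right.mp h
  rw [← mul_one d, ← hT, ← mul_assoc, h2, zero_mul]

namespace IsConnectedGrading
variable (h𝒢 : IsConnectedGrading 𝒢)
include h𝒢

/-- Birkhoff decomposition with respect to a splitting of the target into two subalgebras without
unit.  The negative part is a fixed point of `f ↦ 1 - P ∘ (f ⋆ (γ - 1))`.  Both parts are characters
because on the tensor square `(f ⊗ f) ⋆ (f ∘ mul)⁻¹` differs from `1` by a map that takes values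
in both subalgebras. -/
theorem exists_birkhoff {M N : NonUnitalSubalgebra ℂ S} (hMN : ∀ x ∈ M, x ∈ N → x = 0)
    (P : S →ₗ[ℂ] S) (hPM : ∀ x, P x ∈ M) (hPN : ∀ x, x - P x ∈ N) (γ : H →ₐ[ℂ] S) :
    ∃ γm γp : H →ₐ[ℂ] S, toConv γm.toLinearMap * toConv γ.toLinearMap = toConv γp.toLinearMap ∧
      (∀ x, (toConv γm.toLinearMap - 1) x ∈ M) ∧ (∀ x, (toConv γp.toLinearMap - 1) x ∈ N) := by
  set c := toConv γ.toLinearMap with hc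
  have hc1 : c 1 = 1 := by simp [hc]
  obtain ⟨f, hf⟩ := exists_fixedPoint (𝒢 := 𝒢) (S := S)
    (fun f => (1 : WithConv (H →ₗ[ℂ] S)).ofConv - P ∘ₗ (toConv f * (c - 1)).ofConv) (by
      intro f f' n h x hx
      have := h𝒢.convMul_apply_congr_of_lt (f := toConv f) (f' := toConv f')
        (fun x hx => h𝒢.sub_one_apply_of_mem_zero hc1 hx) h hx
      simp only [LinearMap.sub_apply, LinearMap.comp_apply, this])
  have hfm (x : H) : (toConv f - 1) x = -P ((toConv f * (c - 1)) x) := by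
    have := LinearMap.congr_fun hf x
    simp only [ofConv_sub, LinearMap.sub_apply]
    rw [← this]
    simp
  have hfM (x : H) : (toConv f - 1) x ∈ M := by rw [hfm]; exact neg_mem (hPM _)
  have hkN (x : H) : (toConv f * c - 1) x ∈ N := by
    have : toConv f * c - 1 = toConv f * (c - 1) + (toConv f - 1) := by noncomm_ring
    rw [this, ofConv_add, LinearMap.add_apply, hfm, ← sub_eq_add_neg]
    exact hPN _
  have hf1 : toConv f 1 = 1 := by
    have h0 : (toConv f * (c - 1)) (1 : H) = 0 := by
      rw [convMul_apply_one]; simp [hc1]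
    have := hfm 1
    rw [h0, map_zero, neg_zero] at this
    simpa [sub_eq_zero] using this
  have hk1 : (toConv f * c) 1 = 1 := by rw [convMul_apply_one, hf1, hc1, one_mul]
  obtain ⟨f', hf'1, hf'f, hff'⟩ := h𝒢.exists_inverse hf1
  obtain ⟨k', hk'1, hk'k, hkk'⟩ := h𝒢.exists_inverse hk1
  have hf'M := h𝒢.inverse_sub_one_mem hf1 hf'f hfM
  have hk'N := h𝒢.inverse_sub_one_mem hk1 hk'k hkN
  have hA : tensorSq (toConv f) * compMul f' = tensorSq (toConv f * c) * compMul k' := by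
    have : f' = c * k' := by
      calc f' = f' * (toConv f * c * k') := by rw [hkk', mul_one]
        _ = (f' * toConv f) * (c * k') := by noncomm_ring
        _ = c * k' := by rw [hf'f, one_mul]
    rw [this, compMul_mul, tensorSq_mul (toConv f) c, hc, tensorSq_toLinearMap, mul_assoc]
  have hA1 : tensorSq (toConv f) * compMul f' = 1 := by
    have h1 := mul_sub_one_mem (tensorSq_sub_one_mem hfM) (compMul_sub_one_mem hf'M)
    have h2 := mul_sub_one_mem (tensorSq_sub_one_mem hkN) (compMul_sub_one_mem hk'N)
    rw [← hA] at h2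
    exact sub_eq_zero.mp (WithConv.ext (LinearMap.ext fun t => hMN _ (h1 t) (h2 t)))
  have hmul : compMul (toConv f) = tensorSq (toConv f) := by
    calc compMul (toConv f) = tensorSq (toConv f) * compMul f' * compMul (toConv f) := by
          rw [hA1, one_mul]
      _ = tensorSq (toConv f) := by
          rw [mul_assoc, ← compMul_mul, hf'f, compMul_one, mul_one]
  let γm := homOfTensorSq (toConv f) hf1 hmul
  exact ⟨γm, convHom γm γ, rfl, hfM, hkN⟩

/-- The equation `Y f = f ⋆ B` has at most one solution with `f 1 = 1`: in positive degree it
determines `f` from its values in lower degree. -/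
theorem eq_of_degreeOp_eq {f g B : WithConv (H →ₗ[ℂ] S)} (hB : B 1 = 0) (hf1 : f 1 = 1)
    (hg1 : g 1 = 1) (hf : toConv (f.ofConv ∘ₗ degreeOp 𝒢) = f * B)
    (hg : toConv (g.ofConv ∘ₗ degreeOp 𝒢) = g * B) : f = g := by
  have hB0 : ∀ x ∈ 𝒢 0, B x = 0 := fun x hx => by
    rw [h𝒢.eq_algebraMap_counit hx, Algebra.algebraMap_eq_smul_one, map_smul, hB, smul_zero]
  refine WithConv.ext (linearMap_ext_graded 𝒢 fun n => ?_)
  induction n using Nat.strong_induction_on with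
  | _ n ih =>
    intro x hx
    rcases eq_or_ne n 0 with rfl | hn
    · rw [h𝒢.apply_of_mem_zero hf1 hx, h𝒢.apply_of_mem_zero hg1 hx]
    · have h1 := h𝒢.convMul_apply_congr_of_lt hB0 ih hx
      rw [← hf, ← hg] at h1
      simp only [LinearMap.comp_apply, degreeOp_apply hx, map_smul] at h1
      exact smul_right_injective S (Nat.cast_ne_zero.mpr hn : (n : ℂ) ≠ 0) h1

/-- The only map on the tensor square that is killed by the total grading operator and sends
`1 ⊗ 1` to `1` is the counit. -/
theorem tensor_eq_one_of_degree {V : WithConv (H ⊗[ℂ] H →ₗ[ℂ] S)} (h1 : V 1 = 1)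
    (hV : V.ofConv ∘ₗ (map (degreeOp 𝒢) LinearMap.id + map LinearMap.id (degreeOp 𝒢)) = 0) :
    V = 1 := by
  apply WithConv.ext
  refine TensorProduct.ext (linearMap_ext_graded 𝒢 fun p x hx =>
    linearMap_ext_graded 𝒢 fun q y hy => ?_)
  have h := LinearMap.congr_fun hV (x ⊗ₜ y)
  simp only [LinearMap.comp_apply, LinearMap.add_apply, map_tmul, LinearMap.id_apply,
    degreeOp_apply hx, degreeOp_apply hy, tmul_smul, ← TensorProduct.smul_tmul', ← add_smul,
    map_smul, LinearMap.zero_apply] at h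
  change V (x ⊗ₜ y) = (1 : WithConv (H ⊗[ℂ] H →ₗ[ℂ] S)) (x ⊗ₜ y)
  simp only [LinearMap.convOne_apply, counit_tmul]
  by_cases hpq : p + q = 0
  · obtain ⟨rfl, rfl⟩ : p = 0 ∧ q = 0 := by omega
    rw [h𝒢.eq_algebraMap_counit hx, h𝒢.eq_algebraMap_counit hy]
    simp only [Algebra.algebraMap_eq_smul_one, tmul_smul, ← TensorProduct.smul_tmul', map_smul,
      Bialgebra.counit_one, ← Algebra.TensorProduct.one_def, h1]
    simp [smul_smul]
  · have hne : (p : ℂ) + q ≠ 0 := by exact_mod_cast hpq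
    rw [(smul_eq_zero.mp h).resolve_left hne]
    rcases eq_or_ne p 0 with rfl | hp
    · simp [h𝒢.counit_eq_zero (by omega : q ≠ 0) hy]
    · simp [h𝒢.counit_eq_zero hp hx]

/-- For an infinitesimal character `B` the equation `Y g = g ⋆ B` has a solution in characters.  The
linear solution `f` is multiplicative because `V = (f ∘ mul) ⋆ (f ⊗ f)⁻¹` is killed by the total
grading operator on the tensor square. -/
theorem exists_hom_degreeOp_eq {B : H →ₗ[ℂ] S} (hB : IsInfinitesimalCharacter B) :
    ∃ g : H →ₐ[ℂ] S, toConv (g.toLinearMap ∘ₗ degreeOp 𝒢) = toConv g.toLinearMap * toConv B := by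
  have hB1 : B 1 = 0 := by simpa using hB 1 1
  have hB0 : ∀ x ∈ 𝒢 0, B x = 0 := fun x hx => by
    rw [h𝒢.eq_algebraMap_counit hx, Algebra.algebraMap_eq_smul_one, map_smul, hB1, smul_zero]
  obtain ⟨f, hf⟩ := exists_fixedPoint (𝒢 := 𝒢) (S := S)
    (fun f => (1 : WithConv (H →ₗ[ℂ] S)).ofConv +
      (toConv f * toConv B).ofConv ∘ₗ weight 𝒢 fun n => (n : ℂ)⁻¹) (by
      intro f f' n h x hx
      have := h𝒢.convMul_apply_congr_of_lt (f := toConv f) (f' := toConv f') (h := toConv B)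
        hB0 h hx
      simp only [LinearMap.add_apply, LinearMap.comp_apply, weight_apply _ hx, map_smul, this])
  have hf1 : toConv f 1 = 1 := by
    have := LinearMap.congr_fun hf 1
    rw [LinearMap.add_apply, LinearMap.comp_apply,
      weight_apply _ (SetLike.GradedOne.one_mem : (1 : H) ∈ 𝒢 0)] at this
    simpa using this.symm
  have hfY : toConv (f ∘ₗ degreeOp 𝒢) = toConv f * toConv B := by
    refine WithConv.ext (linearMap_ext_graded 𝒢 fun n x hx => ?_)
    rw [ofConv_toConv, LinearMap.comp_apply, degreeOp_apply hx, map_smul]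
    rcases eq_or_ne n 0 with rfl | hn
    · have h0 : (toConv f * toConv B) x ∈ (⊥ : Submodule ℂ S) :=
        h𝒢.convMul_apply_mem (fun p q hpq a ha b hb => by
          obtain rfl : q = 0 := by omega
          simp [hB0 b hb]) hx
      rw [(Submodule.mem_bot ℂ).mp h0]
      simp
    · have := LinearMap.congr_fun hf x
      rw [← this, LinearMap.add_apply, LinearMap.comp_apply, weight_apply _ hx,
        h𝒢.one_apply_of_ne hn hx, map_smul, zero_add, smul_smul,
        mul_inv_cancel₀ (Nat.cast_ne_zero.mpr hn : (n : ℂ) ≠ 0), one_smul]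
  obtain ⟨f', hf'1, hf'f, hff'⟩ := h𝒢.exists_inverse hf1
  let N := map (degreeOp 𝒢) LinearMap.id + map LinearMap.id (degreeOp 𝒢)
  have hN := comul_tensor_coderivation h𝒢.comul_degreeOp
  let V := compMul (toConv f) * tensorSq f'
  have hVf : V * tensorSq (toConv f) = compMul (toConv f) := by
    rw [mul_assoc, ← tensorSq_mul, hf'f, tensorSq_one, mul_one]
  have hT : toConv ((tensorSq (toConv f)).ofConv ∘ₗ N) =
      tensorSq (toConv f) * compMul (toConv B) := by
    have e1 : toConv ((tensorSq (toConv f)).ofConv ∘ₗ N) =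
        toConv (LinearMap.mul' ℂ S ∘ₗ map (toConv f * toConv B).ofConv (toConv f * 1).ofConv) +
        toConv (LinearMap.mul' ℂ S ∘ₗ map (toConv f * 1).ofConv (toConv f * toConv B).ofConv) := by
      rw [← hfY, mul_one]
      apply WithConv.ext
      ext x y
      simp [tensorSq, N]
    rw [e1, mul'_map_convMul, mul'_map_convMul, ← mul_add]
    congr 1
    apply WithConv.ext
    ext x y
    simp [compMul, hB x y]
  have hM : toConv ((compMul (toConv f)).ofConv ∘ₗ N) =
      compMul (toConv f) * compMul (toConv B) := by
    rw [← compMul_mul, ← hfY]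
    apply WithConv.ext
    ext x y
    simp [compMul, N, degreeOp_mul]
  have hVN : toConv (V.ofConv ∘ₗ N) = 0 := by
    have h := convMul_comp_coderivation hN V (tensorSq (toConv f))
    rw [hVf, hM, hT, ← hVf] at h
    refine eq_zero_of_mul_add_eq h.symm (T' := tensorSq f') ?_
    rw [← tensorSq_mul, hff', tensorSq_one]
  have hV : V = 1 := h𝒢.tensor_eq_one_of_degree (by
    rw [convMul_apply_one, compMul_apply_one, tensorSq_apply_one, hf1, hf'1]; simp)
    (congrArg ofConv hVN)
  rw [hV, one_mul] at hVf
  exact ⟨homOfTensorSq (toConv f) hf1 hVf.symm, hfY⟩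

end IsConnectedGrading
end TensorSquare

/-! ### Laurent series: regular and polar parts, derivations, exponentials -/

theorem ext_zcoeff {f g : 𝓐} (h : ∀ n, zcoeff n f = zcoeff n g) : f = g :=
  HahnSeries.ext (funext h)

theorem zcoeff_mul (f g : 𝓐) (n : ℤ) : zcoeff n (f * g) =
    ∑ ij ∈ Finset.antidiagonal (HahnSeries.isPWO_support f) (HahnSeries.isPWO_support g) n,
      zcoeff ij.1 f * zcoeff ij.2 g := HahnSeries.coeff_mul

theorem zcoeff_mul_eq_zero {f g : 𝓐} {n : ℤ}
    (h : ∀ i j, i + j = n → zcoeff i f * zcoeff j g = 0) : zcoeff n (f * g) = 0 := by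
  rw [zcoeff_mul]
  refine Finset.sum_eq_zero fun ij hij => h _ _ ?_
  exact (Finset.mem_antidiagonal.mp hij).2.2

theorem zcoeff_algebraMap (c : ℂ) (n : ℤ) :
    zcoeff n (algebraMap ℂ 𝓐 c) = if n = 0 then c else 0 :=
  HahnSeries.coeff_single.trans (by congr)

theorem zcoeff_ofPowerSeries (p : PowerSeries ℂ) (n : ℕ) :
    zcoeff n (ofPowerSeries p) = PowerSeries.coeff n p := HahnSeries.ofPowerSeries_apply_coeff p n

theorem isRegular_ofPowerSeries (p : PowerSeries ℂ) : IsRegular (ofPowerSeries p) := by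
  intro n hn
  change HahnSeries.coeff (HahnSeries.ofPowerSeries ℤ ℂ p) n = 0
  rw [HahnSeries.ofPowerSeries_apply, HahnSeries.embDomain_of_notMem_range]
  rintro ⟨m, rfl⟩
  exact absurd hn (by simp)

/-- The algebra of series without pole. -/
def regularSeries : Subalgebra ℂ 𝓐 where
  carrier := {f | IsRegular f}
  mul_mem' {f g} hf hg n hn := zcoeff_mul_eq_zero fun i j hij => by
    rcases lt_or_ge i 0 with hi | hi
    · rw [hf i hi, zero_mul]
    · rw [hg j (by omega), mul_zero]
  add_mem' {f g} hf hg n hn := by rw [map_add, hf n hn, hg n hn, add_zero]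
  algebraMap_mem' c n hn := by rw [zcoeff_algebraMap, if_neg hn.ne]

theorem mem_regularSeries {f : 𝓐} : f ∈ regularSeries ↔ IsRegular f := Iff.rfl

/-- The algebra without unit of pure poles. -/
def polarSeries : NonUnitalSubalgebra ℂ 𝓐 where
  carrier := {f | IsPolar f}
  mul_mem' {f g} hf hg n hn := zcoeff_mul_eq_zero fun i j hij => by
    rcases lt_or_ge i 0 with hi | hi
    · rw [hg j (by omega), mul_zero]
    · rw [hf i hi, zero_mul]
  add_mem' {f g} hf hg n hn := by rw [map_add, hf n hn, hg n hn, add_zero]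
  zero_mem' n hn := map_zero _
  smul_mem' c f hf n hn := by rw [map_smul, hf n hn, smul_zero]

theorem mem_polarSeries {f : 𝓐} : f ∈ polarSeries ↔ IsPolar f := Iff.rfl

/-- The polar part of a Laurent series. -/
def polarPart : 𝓐 →ₗ[ℂ] 𝓐 where
  toFun f := (⟨fun n => if n < 0 then zcoeff n f else 0,
    (HahnSeries.isPWO_support f).mono fun n hn => by
      rw [Function.mem_support] at hn
      exact fun h => hn (by split_ifs <;> [exact h; rfl])⟩ : HahnSeries ℤ ℂ)
  map_add' f g := ext_zcoeff fun n => by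
    change (if n < 0 then zcoeff n (f + g) else 0) =
      (if n < 0 then zcoeff n f else 0) + if n < 0 then zcoeff n g else 0
    split_ifs <;> simp
  map_smul' c f := ext_zcoeff fun n => by
    change (if n < 0 then zcoeff n (c • f) else 0) = c • if n < 0 then zcoeff n f else 0
    split_ifs <;> simp

theorem zcoeff_polarPart (f : 𝓐) (n : ℤ) :
    zcoeff n (polarPart f) = if n < 0 then zcoeff n f else 0 := rfl

theorem isPolar_polarPart (f : 𝓐) : IsPolar (polarPart f) := fun n hn => by
  rw [zcoeff_polarPart, if_neg (not_lt.mpr hn)]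

theorem isRegular_sub_polarPart (f : 𝓐) : IsRegular (f - polarPart f) := fun n hn => by
  rw [map_sub, zcoeff_polarPart, if_pos hn, sub_self]

theorem eq_zero_of_isPolar_of_isRegular {f : 𝓐} (h : IsPolar f) (h' : IsRegular f) : f = 0 :=
  ext_zcoeff fun n => by
    rcases lt_or_ge n 0 with hn | hn
    · rw [h' n hn, map_zero]
    · rw [h n hn, map_zero]

theorem zcoeff_zero_mul {f g : 𝓐} (hf : IsRegular f) (hg : IsRegular g) :
    zcoeff 0 (f * g) = zcoeff 0 f * zcoeff 0 g := by
  rw [zcoeff_mul, Finset.sum_eq_single (0, 0)]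
  · rintro ⟨i, j⟩ hij hne
    have h0 : i + j = 0 := (Finset.mem_antidiagonal.mp hij).2.2
    rcases lt_trichotomy i 0 with hi | rfl | hi
    · rw [hf i hi, zero_mul]
    · exact absurd (by simpa using h0) hne
    · rw [hg j (by omega), mul_zero]
  · intro h
    by_contra hne
    refine h (Finset.mem_antidiagonal.mpr ⟨?_, ?_, add_zero 0⟩)
    · exact left_ne_zero_of_mul hne
    · exact right_ne_zero_of_mul hne

/-- Evaluation at `z = 0` of series without pole. -/
def evalZero : regularSeries →ₐ[ℂ] ℂ :=
  AlgHom.ofLinearMap (zcoeff 0 ∘ₗ regularSeries.val.toLinearMap)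
    (by
      change zcoeff 0 (1 : 𝓐) = 1
      rw [← map_one (algebraMap ℂ 𝓐), zcoeff_algebraMap, if_pos rfl])
    (fun f g => zcoeff_zero_mul f.2 g.2)

/-- The monomial `z ^ n`. -/
def zpow (n : ℤ) : 𝓐 := HahnSeries.single n (1 : ℂ)

theorem zcoeff_zpow_mul (n m : ℤ) (f : 𝓐) : zcoeff m (zpow n * f) = zcoeff (m - n) f :=
  (HahnSeries.coeff_single_mul (Γ' := ℤ)).trans (one_mul _)

theorem zpow_mul_zpow (n m : ℤ) : zpow n * zpow m = zpow (n + m) := by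
  refine (HahnSeries.single_mul_single (R := ℂ)).trans ?_
  rw [one_mul]; rfl

theorem zpow_zero : zpow 0 = 1 := rfl

theorem ofPowerSeries_X : ofPowerSeries PowerSeries.X = zpow 1 := HahnSeries.ofPowerSeries_X

theorem exists_eq_zpow_mul (f : 𝓐) : ∃ n p, f = zpow n * ofPowerSeries p :=
  ⟨_, _, (LaurentSeries.single_order_mul_powerSeriesPart f).symm⟩

theorem isRegular_zpow_one_mul {f : 𝓐} :
    IsRegular (zpow 1 * f) ↔ ∀ i < -1, zcoeff i f = 0 := by
  constructor
  · intro h i hi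
    have := h (i + 1) (by omega)
    rwa [zcoeff_zpow_mul, add_sub_cancel_right] at this
  · intro h i hi
    rw [zcoeff_zpow_mul]
    exact h _ (by omega)

theorem zcoeff_neg_one (f : 𝓐) : zcoeff (-1) f = zcoeff 0 (zpow 1 * f) := by
  rw [zcoeff_zpow_mul]; rfl

theorem zcoeff_ddz (f : 𝓐) (n : ℤ) : zcoeff n (ddz f) = (n + 1) * zcoeff (n + 1) f := by
  have : zcoeff n (ddz f) = Ring.choose (n + (1 : ℕ)) 1 • zcoeff (n + (1 : ℕ)) f :=
    LaurentSeries.hasseDeriv_coeff (R := ℂ) 1 f n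
  rw [this, Ring.choose_one_right]
  simp

theorem ddz_mul (f g : 𝓐) : ddz (f * g) = ddz f * g + f * ddz g := by
  have hE (f : 𝓐) (n : ℤ) : zcoeff n (zpow 1 * ddz f) = n * zcoeff n f := by
    rw [zcoeff_zpow_mul, zcoeff_ddz]; simp
  have hs (f : 𝓐) : HahnSeries.support (zpow 1 * ddz f) ⊆ HahnSeries.support f := by
    intro n hn hf
    have : zcoeff n f = 0 := hf
    exact hn ((hE f n).trans (by rw [this, mul_zero]))
  -- the Euler operator `z d/dz` acts on coefficients by `n`, so Leibniz is `n = i + j`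
  have key : zpow 1 * ddz (f * g) = zpow 1 * ddz f * g + f * (zpow 1 * ddz g) := by
    refine ext_zcoeff fun n => ?_
    rw [hE, map_add, zcoeff_mul, Finset.mul_sum]
    have h1 : zcoeff n (zpow 1 * ddz f * g) =
        ∑ ij ∈ Finset.antidiagonal (HahnSeries.isPWO_support f) (HahnSeries.isPWO_support g) n,
          zcoeff ij.1 (zpow 1 * ddz f) * zcoeff ij.2 g :=
      HahnSeries.coeff_mul_left' _ (hs f)
    have h2 : zcoeff n (f * (zpow 1 * ddz g)) =
        ∑ ij ∈ Finset.antidiagonal (HahnSeries.isPWO_support f) (HahnSeries.isPWO_support g) n,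
          zcoeff ij.1 f * zcoeff ij.2 (zpow 1 * ddz g) :=
      HahnSeries.coeff_mul_right' _ (hs g)
    rw [h1, h2, ← Finset.sum_add_distrib]
    refine Finset.sum_congr rfl fun ij hij => ?_
    rw [hE, hE, ← (Finset.mem_antidiagonal.mp hij).2.2]
    push_cast
    ring
  have h2 := congrArg (zpow (-1) * ·) key
  have h3 : zpow (-1) * zpow 1 = 1 := by rw [zpow_mul_zpow]; rfl
  simp only [mul_add, ← mul_assoc, h3, one_mul] at h2
  rw [h2, mul_comm (zpow (-1)) f, mul_assoc f, h3, mul_one]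

theorem ddz_algebraMap (c : ℂ) : ddz (algebraMap ℂ 𝓐 c) = 0 := by
  refine ext_zcoeff fun n => ?_
  rw [zcoeff_ddz, zcoeff_algebraMap, map_zero]
  split_ifs with h
  · have : (n : ℂ) + 1 = 0 := by exact_mod_cast h
    rw [this, zero_mul]
  · rw [mul_zero]

theorem ddz_pow (f : 𝓐) (n : ℕ) : ddz (f ^ n) * f = n * f ^ n * ddz f := by
  induction n with
  | zero =>
    have : ddz (1 : 𝓐) = 0 := by rw [← map_one (algebraMap ℂ 𝓐), ddz_algebraMap]
    simp [this]
  | succ n ih =>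
    rw [pow_succ, ddz_mul, add_mul, mul_right_comm, ih]
    push_cast
    ring

/-- `exp (s z)`, a unit among power series, as a section of `B → Δ`. -/
def expUnit (s : ℂ) : (PowerSeries ℂ)ˣ where
  val := PowerSeries.rescale s (PowerSeries.exp ℂ)
  inv := PowerSeries.rescale s (PowerSeries.evalNegHom (PowerSeries.exp ℂ))
  val_inv := by rw [← map_mul, PowerSeries.exp_mul_exp_neg_eq_one, map_one]
  inv_val := by rw [mul_comm, ← map_mul, PowerSeries.exp_mul_exp_neg_eq_one, map_one]

theorem sectionUnit_expUnit (s : ℂ) : ((sectionUnit (expUnit s) : 𝓐ˣ) : 𝓐) = expz s := rfl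

theorem constantCoeff_expUnit (s : ℂ) :
    PowerSeries.constantCoeff (expUnit s : PowerSeries ℂ) = 1 := by
  simp [expUnit, ← PowerSeries.coeff_zero_eq_constantCoeff_apply, PowerSeries.coeff_rescale]

theorem expz_zero : expz 0 = 1 := by
  simp [expz]

theorem isRegular_expz (s : ℂ) : IsRegular (expz s) := isRegular_ofPowerSeries _

/-- Two sections with the same value at `z = 0` differ by a factor `1 + z w`, `w` regular. -/
theorem sectionUnit_eq_mul (σ σ' : (PowerSeries ℂ)ˣ)
    (h : PowerSeries.constantCoeff (σ : PowerSeries ℂ) =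
      PowerSeries.constantCoeff (σ' : PowerSeries ℂ)) :
    ∃ w : 𝓐, IsRegular w ∧ (sectionUnit σ' : 𝓐) = sectionUnit σ * (1 + zpow 1 * w) := by
  have h1 : PowerSeries.constantCoeff ((σ' - σ : PowerSeries ℂ)) = 0 := by
    rw [map_sub, h, sub_self]
  obtain ⟨v, hv⟩ := PowerSeries.X_dvd_iff.mpr h1
  refine ⟨ofPowerSeries (v * ((σ⁻¹ : (PowerSeries ℂ)ˣ) : PowerSeries ℂ)),
    isRegular_ofPowerSeries _, ?_⟩
  rw [← ofPowerSeries_X, ← map_mul, ← map_one ofPowerSeries, ← map_add]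
  change ofPowerSeries σ' = ofPowerSeries σ * _
  rw [← map_mul, ← mul_assoc, ← hv]
  congr 1
  rw [mul_add, mul_one, mul_left_comm, Units.mul_inv]
  ring

/-- Each coefficient of `c * exp (s z) ^ n` is a polynomial in `s`. -/
theorem hasDerivAt_zcoeff_mul_expz_pow (c : 𝓐) (n : ℕ) (i : ℤ) :
    HasDerivAt (fun s : ℂ => zcoeff i (c * expz s ^ n)) (n * zcoeff (i - 1) c) 0 := by
  obtain ⟨N, p, rfl⟩ := exists_eq_zpow_mul c
  rcases lt_or_ge i N with hi | hi
  · have h1 : ∀ s : ℂ, zcoeff i (zpow N * ofPowerSeries p * expz s ^ n) = 0 := fun s => by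
      rw [mul_assoc, zcoeff_zpow_mul]
      exact regularSeries.mul_mem (isRegular_ofPowerSeries p)
        (regularSeries.pow_mem (isRegular_expz s) n) _ (by omega)
    have h2 : zcoeff (i - 1) (zpow N * ofPowerSeries p) = 0 := by
      rw [zcoeff_zpow_mul]
      exact isRegular_ofPowerSeries p _ (by omega)
    simp only [h1, h2, mul_zero]
    exact hasDerivAt_const _ _
  · obtain ⟨m, hm⟩ := Int.eq_ofNat_of_zero_le (sub_nonneg.mpr hi)
    have h1 : ∀ s : ℂ, zcoeff i (zpow N * ofPowerSeries p * expz s ^ n) =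
        ∑ ab ∈ Finset.HasAntidiagonal.antidiagonal m, PowerSeries.coeff ab.1 p *
          (s ^ ab.2 * ((n : ℂ) ^ ab.2 * algebraMap ℚ ℂ (1 / (ab.2.factorial : ℚ)))) := fun s => by
      rw [mul_assoc, zcoeff_zpow_mul, hm, expz, ← map_pow, ← map_mul, zcoeff_ofPowerSeries,
        PowerSeries.coeff_mul, ← map_pow, PowerSeries.exp_pow_eq_rescale_exp]
      simp only [PowerSeries.coeff_rescale, PowerSeries.coeff_exp]
    have h2 : n * zcoeff (i - 1) (zpow N * ofPowerSeries p) =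
        ∑ ab ∈ Finset.HasAntidiagonal.antidiagonal m, PowerSeries.coeff ab.1 p *
          (if ab.2 = 1 then (n : ℂ) else 0) := by
      have : zcoeff (i - 1) (zpow N * ofPowerSeries p) =
          PowerSeries.coeff m (p * PowerSeries.X) := by
        rw [← zcoeff_ofPowerSeries, ofPowerSeries.map_mul, ofPowerSeries_X,
          mul_comm (ofPowerSeries p), zcoeff_zpow_mul, zcoeff_zpow_mul, ← hm, sub_right_comm]
      rw [this, PowerSeries.coeff_mul, Finset.mul_sum]
      refine Finset.sum_congr rfl fun ab _ => ?_
      rw [PowerSeries.coeff_X]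
      split_ifs <;> ring
    simp only [h1, h2]
    refine HasDerivAt.fun_sum fun ab _ => HasDerivAt.const_mul _ ?_
    rcases ab with ⟨a, b⟩
    have h := (hasDerivAt_pow b (0 : ℂ)).mul_const
      ((n : ℂ) ^ b * algebraMap ℚ ℂ (1 / (b.factorial : ℚ)))
    convert h using 1
    rcases b with _ | _ | b <;> simp

/-! ### Operators on Laurent polynomials in `t` -/

open LaurentPolynomial in
theorem termwise_C_mul_T (L : ℤ → 𝓐 →ₗ[ℂ] 𝓐) (c : 𝓐) (n : ℤ) :
    termwise L (C c * T n) = C (L n c) * T n := by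
  rw [← single_eq_C_mul_T, ← single_eq_C_mul_T]
  exact Finsupp.sum_single_index (h := fun n c => AddMonoidAlgebra.single n (L n c)) (by simp)

open LaurentPolynomial in
/-- Biadditive maps on `𝓑` agree if they agree on monomials. -/
theorem bilinear_ext {M : Type*} [AddCommMonoid M] {F G : 𝓑 → 𝓑 → M}
    (hF : ∀ p q r, F (p + q) r = F p r + F q r) (hF' : ∀ p q r, F r (p + q) = F r p + F r q)
    (hG : ∀ p q r, G (p + q) r = G p r + G q r) (hG' : ∀ p q r, G r (p + q) = G r p + G r q)
    (h : ∀ c n d m, F (C c * T n) (C d * T m) = G (C c * T n) (C d * T m)) (p q : 𝓑) :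
    F p q = G p q := by
  induction p using LaurentPolynomial.induction_on' with
  | add p p' hp hp' => rw [hF, hG, hp, hp']
  | C_mul_T n c =>
    induction q using LaurentPolynomial.induction_on' with
    | add q q' hq hq' => rw [hF', hG', hq, hq']
    | C_mul_T m d => exact h c n d m

open LaurentPolynomial in
theorem C_mul_T_mul (c d : 𝓐) (n m : ℤ) :
    (C c * T n * (C d * T m) : 𝓑) = C (c * d) * T (n + m) := by
  rw [map_mul, T_add]; ring

open LaurentPolynomial in
theorem pdz_mul (p q : 𝓑) : pdz (p * q) = pdz p * q + p * pdz q := by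
  refine bilinear_ext (F := fun p q => pdz (p * q)) (G := fun p q => pdz p * q + p * pdz q)
    (fun p q r => ?_) (fun p q r => ?_) (fun p q r => ?_) (fun p q r => ?_)
    (fun c n d m => ?_) p q
  · simp only [add_mul, map_add]
  · simp only [mul_add, map_add]
  · simp only [add_mul, map_add]; abel
  · simp only [mul_add, map_add]; abel
  · simp only [C_mul_T_mul, pdz, termwise_C_mul_T, ddz_mul, map_add, add_mul]

open LaurentPolynomial in
theorem tpdt_C_mul_T (c : 𝓐) (n : ℤ) :
    tpdt (C c * T n) = algebraMap ℂ 𝓑 n * (C c * T n) := by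
  rw [tpdt, termwise_C_mul_T, LinearMap.smul_apply, LinearMap.id_apply, ← Algebra.smul_def,
    ← smul_mul_assoc]
  congr 1
  rw [Algebra.smul_def, Algebra.smul_def, map_mul]
  rfl

theorem tpdt_mul (p q : 𝓑) : tpdt (p * q) = tpdt p * q + p * tpdt q := by
  refine bilinear_ext (F := fun p q => tpdt (p * q)) (G := fun p q => tpdt p * q + p * tpdt q)
    (fun p q r => ?_) (fun p q r => ?_) (fun p q r => ?_) (fun p q r => ?_)
    (fun c n d m => ?_) p q
  · simp only [add_mul, map_add]
  · simp only [mul_add, map_add]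
  · simp only [add_mul, map_add]; abel
  · simp only [mul_add, map_add]; abel
  · rw [C_mul_T_mul, tpdt_C_mul_T, tpdt_C_mul_T, tpdt_C_mul_T, ← C_mul_T_mul]
    rw [Int.cast_add, map_add]
    ring

open LaurentPolynomial in
theorem rescale_C_mul_T (u : ℂˣ) (c : 𝓐) (n : ℤ) :
    rescale u (C c * T n) = algebraMap ℂ 𝓑 ((u ^ n : ℂˣ) : ℂ) * (C c * T n) := by
  rw [rescale, termwise_C_mul_T, LinearMap.smul_apply, LinearMap.id_apply, ← Algebra.smul_def,
    ← smul_mul_assoc]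
  congr 1
  rw [Algebra.smul_def, Algebra.smul_def, map_mul]
  rfl

theorem rescale_mul (u : ℂˣ) (p q : 𝓑) : rescale u (p * q) = rescale u p * rescale u q := by
  refine bilinear_ext (F := fun p q => rescale u (p * q))
    (G := fun p q => rescale u p * rescale u q)
    (fun p q r => ?_) (fun p q r => ?_) (fun p q r => ?_) (fun p q r => ?_)
    (fun c n d m => ?_) p q
  · simp only [add_mul, map_add]
  · simp only [mul_add, map_add]
  · simp only [add_mul, map_add]
  · simp only [mul_add, map_add]
  · rw [C_mul_T_mul, rescale_C_mul_T, rescale_C_mul_T, rescale_C_mul_T, ← C_mul_T_mul, zpow_add,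
      Units.val_mul, map_mul]
    ring

open LaurentPolynomial in
theorem one_eq_C_mul_T : (1 : 𝓑) = C 1 * T 0 := by simp

open LaurentPolynomial in
/-- `f(z, t) ↦ f(z, u t)` as an algebra homomorphism. -/
def rescaleHom (u : ℂˣ) : 𝓑 →ₐ[ℂ] 𝓑 :=
  AlgHom.ofLinearMap (rescale u) (by rw [one_eq_C_mul_T, rescale_C_mul_T]; simp) (rescale_mul u)

open LaurentPolynomial in
theorem linearMap_ext_C_mul_T {M : Type*} [AddCommMonoid M] [Module ℂ M] {F G : 𝓑 →ₗ[ℂ] M}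
    (h : ∀ c n, F (C c * T n) = G (C c * T n)) : F = G := by
  refine LinearMap.ext fun p => ?_
  induction p using LaurentPolynomial.induction_on' with
  | add p p' hp hp' => rw [map_add, map_add, hp, hp']
  | C_mul_T n c => exact h c n

theorem rescale_comp_pdz (u : ℂˣ) : rescale u ∘ₗ pdz = pdz ∘ₗ rescale u :=
  linearMap_ext_C_mul_T fun c n => by
    rw [LinearMap.comp_apply, LinearMap.comp_apply, rescale_C_mul_T, ← Algebra.smul_def, map_smul,
      pdz, termwise_C_mul_T, rescale_C_mul_T, Algebra.smul_def]

theorem rescale_comp_tpdt (u : ℂˣ) : rescale u ∘ₗ tpdt = tpdt ∘ₗ rescale u :=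
  linearMap_ext_C_mul_T fun c n => by
    rw [LinearMap.comp_apply, LinearMap.comp_apply, rescale_C_mul_T, tpdt_C_mul_T,
      ← Algebra.smul_def, ← Algebra.smul_def, map_smul, map_smul, tpdt_C_mul_T, rescale_C_mul_T,
      Algebra.smul_def, Algebra.smul_def, mul_left_comm]

open LaurentPolynomial in
theorem subst_C_mul_T (τ : 𝓐ˣ) (c : 𝓐) (n : ℤ) :
    subst τ (C c * T n) = c * ((τ ^ n : 𝓐ˣ) : 𝓐) :=
  smeval_C_mul_T_n τ n c

theorem subst_mul (τ : 𝓐ˣ) (p q : 𝓑) : subst τ (p * q) = subst τ p * subst τ q := by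
  refine bilinear_ext (F := fun p q => subst τ (p * q))
    (G := fun p q => subst τ p * subst τ q)
    (fun p q r => ?_) (fun p q r => ?_) (fun p q r => ?_) (fun p q r => ?_)
    (fun c n d m => ?_) p q
  · simp only [add_mul, map_add]
  · simp only [mul_add, map_add]
  · simp only [add_mul, map_add]
  · simp only [mul_add, map_add]
  · rw [C_mul_T_mul, subst_C_mul_T, subst_C_mul_T, subst_C_mul_T, zpow_add, Units.val_mul]
    ring

/-- `f(z, t) ↦ f(z, τ(z))` as an algebra homomorphism. -/
def substHom (τ : 𝓐ˣ) : 𝓑 →ₐ[ℂ] 𝓐 :=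
  AlgHom.ofLinearMap (subst τ) (by rw [one_eq_C_mul_T, subst_C_mul_T]; simp) (subst_mul τ)

theorem toLinearMap_substHom (τ : 𝓐ˣ) : (substHom τ).toLinearMap = subst τ := rfl

/-- The inclusion of `𝓐` into `𝓑` as an algebra homomorphism over the scalars. -/
def constHom : 𝓐 →ₐ[ℂ] 𝓑 :=
  AlgHom.ofLinearMap ((Algebra.linearMap 𝓐 𝓑).restrictScalars ℂ)
    (map_one (algebraMap 𝓐 𝓑)) (map_mul (algebraMap 𝓐 𝓑))

/-- The elements of `𝓑` without pole in `z`. -/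
def regularB : Submodule ℂ 𝓑 where
  carrier := {p | ∀ n : ℤ, IsRegular (p.coeff n)}
  add_mem' hp hq n := regularSeries.add_mem (hp n) (hq n)
  zero_mem' _ := regularSeries.zero_mem
  smul_mem' c _ hp n := regularSeries.smul_mem (hp n) c

theorem mem_regularB {p : 𝓑} : p ∈ regularB ↔ ∀ n : ℤ, IsRegular (p.coeff n) := Iff.rfl

open LaurentPolynomial in
theorem C_mul_T_mem_regularB {c : 𝓐} (hc : IsRegular c) (n : ℤ) :
    (C c * T n : 𝓑) ∈ regularB := by
  intro m
  rw [← single_eq_C_mul_T]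
  rcases eq_or_ne n m with rfl | h
  · rw [AddMonoidAlgebra.coeff_single, Finsupp.single_eq_same]; exact hc
  · rw [AddMonoidAlgebra.coeff_single, Finsupp.single_eq_of_ne' h]; exact regularSeries.zero_mem

theorem isRegular_subst_one {p : 𝓑} (hp : p ∈ regularB) : IsRegular (subst 1 p) := by
  change (p.coeff.sum fun n r => r • (((1 : 𝓐ˣ) ^ n : 𝓐ˣ) : 𝓐)) ∈ regularSeries
  refine sum_mem fun n _ => ?_
  change p.coeff n • (((1 : 𝓐ˣ) ^ n : 𝓐ˣ) : 𝓐) ∈ regularSeries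
  rw [one_zpow, Units.val_one, smul_eq_mul, mul_one]
  exact hp n

theorem tpdt_mem_regularB {p : 𝓑} (hp : p ∈ regularB) : tpdt p ∈ regularB := by
  change (p.coeff.sum fun n c => AddMonoidAlgebra.single n (((n : ℂ) • LinearMap.id) c)) ∈ regularB
  refine sum_mem fun n _ => ?_
  change AddMonoidAlgebra.single n ((n : ℂ) • p.coeff n) ∈ regularB
  rw [LaurentPolynomial.single_eq_C_mul_T]
  exact C_mul_T_mem_regularB (regularSeries.smul_mem (hp n) _) n

/-! ### Sections and pullbacks of the connection -/

section Connection
variable {H : Type*} [CommRing H] [HopfAlgebra ℂ H] {S : Type*} [CommRing S] [Algebra ℂ S]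
  {S' : Type*} [CommRing S'] [Algebra ℂ S']

theorem comp_logDeriv (φ : S →ₐ[ℂ] S') (d : S →ₗ[ℂ] S) (f : H →ₗ[ℂ] S) :
    φ.toLinearMap ∘ₗ logDeriv d f = conv (inv (φ.toLinearMap ∘ₗ f)) (φ.toLinearMap ∘ₗ d ∘ₗ f) :=
  comp_convMul_of_algHom φ (inv f) (d ∘ₗ f)

/-- The logarithmic derivative of a product: `D(fg) = Dg + g⁻¹ (Df) g`. -/
theorem logDeriv_conv {d : S →ₗ[ℂ] S} (hd : ∀ a b, d (a * b) = d a * b + a * d b)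
    (f g : H →ₐ[ℂ] S) :
    logDeriv d (conv f.toLinearMap g.toLinearMap) =
      logDeriv d g.toLinearMap + conjBy g.toLinearMap (logDeriv d f.toLinearMap) := by
  have h1 := toConv_comp_convMul_of_derivation hd f.toLinearMap g.toLinearMap
  have h2 : toConv (inv (conv f.toLinearMap g.toLinearMap)) =
      toConv (inv g.toLinearMap) * toConv (inv f.toLinearMap) := by
    refine left_inv_eq_right_inv (toConv_inv_mul (convHom f g)) ?_
    rw [toLinearMap_convHom, toConv_conv, mul_assoc, ← mul_assoc (toConv g.toLinearMap),
      toConv_mul_inv, one_mul, toConv_mul_inv]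
  apply toConv_injective
  have h3 : toConv (d ∘ₗ conv f.toLinearMap g.toLinearMap) = _ := h1
  simp only [logDeriv, conjBy, toConv_conv, toConv_add]
  rw [h2, h3, mul_add, mul_assoc, mul_assoc,
    ← mul_assoc (toConv (inv f.toLinearMap)) (toConv f.toLinearMap), toConv_inv_mul, one_mul,
    add_comm, ← mul_assoc (toConv (inv f.toLinearMap))]

variable {𝒢 : ℕ → Submodule ℂ H} [GradedAlgebra 𝒢]

variable (𝒢) in
/-- The section `γ_t` as a character. -/
def gammaTHom (γ : H →ₐ[ℂ] 𝓐) : H →ₐ[ℂ] 𝓑 :=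
  twistHom 𝒢 (LaurentPolynomial.T 1 : 𝓑) (constHom.comp γ)

theorem toLinearMap_gammaTHom (γ : H →ₐ[ℂ] 𝓐) :
    (gammaTHom 𝒢 γ).toLinearMap = gammaT 𝒢 γ.toLinearMap := rfl

theorem gammaTHom_apply (γ : H →ₐ[ℂ] 𝓐) (x : H) :
    gammaTHom 𝒢 γ x = gammaT 𝒢 γ.toLinearMap x := rfl

open LaurentPolynomial in
theorem gammaT_apply (γ : H →ₗ[ℂ] 𝓐) {n : ℕ} {x : H} (hx : x ∈ 𝒢 n) :
    gammaT 𝒢 γ x = C (γ x) * T n := by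
  rw [gammaT, twist_apply _ _ hx, T_pow, mul_one, mul_comm]
  rfl

theorem gammaT_mem_regularB {γ : H →ₗ[ℂ] 𝓐} (hγ : ∀ x, IsRegular (γ x)) (x : H) :
    gammaT 𝒢 γ x ∈ regularB := by
  induction x using DirectSum.Decomposition.inductionOn 𝒢 with
  | zero => simp
  | homogeneous a => rw [gammaT_apply _ a.2]; exact C_mul_T_mem_regularB (hγ _) _
  | add a b ha hb => rw [map_add]; exact add_mem ha hb

theorem subst_gammaT (τ : 𝓐ˣ) (γ : H →ₗ[ℂ] 𝓐) :
    subst τ ∘ₗ gammaT 𝒢 γ = twist 𝒢 (τ : 𝓐) γ :=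
  linearMap_ext_graded 𝒢 fun n x hx => by
    rw [LinearMap.comp_apply, gammaT_apply _ hx, subst_C_mul_T, twist_apply _ _ hx, mul_comm]
    simp

theorem subst_tpdt_gammaT (τ : 𝓐ˣ) (γ : H →ₗ[ℂ] 𝓐) :
    subst τ ∘ₗ tpdt ∘ₗ gammaT 𝒢 γ = twist 𝒢 (τ : 𝓐) γ ∘ₗ degreeOp 𝒢 :=
  linearMap_ext_graded 𝒢 fun n x hx => by
    rw [LinearMap.comp_apply, LinearMap.comp_apply, LinearMap.comp_apply, gammaT_apply _ hx,
      tpdt_C_mul_T, ← Algebra.smul_def, map_smul, subst_C_mul_T, degreeOp_apply hx, map_smul,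
      twist_apply _ _ hx, mul_comm]
    simp

/-- `b(z, 1) = γ⁻¹ ⋆ Y γ`. -/
theorem bComponent_eq (γ : H →ₗ[ℂ] 𝓐) :
    bComponent 𝒢 γ = conv (inv γ) (γ ∘ₗ degreeOp 𝒢) := by
  have h := comp_logDeriv (substHom 1) tpdt (gammaT 𝒢 γ)
  simp only [toLinearMap_substHom, subst_gammaT, subst_tpdt_gammaT, Units.val_one,
    twist_one_left] at h
  exact h

/-- The restriction of `γ_t^* ω` to a section is the logarithmic derivative of the restriction of
`γ_t`, by the chain rule. -/
theorem restrict_pullback (γ : H →ₗ[ℂ] 𝓐) (σ : (PowerSeries ℂ)ˣ) :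
    (pullback 𝒢 γ).restrict σ = logDeriv ddz (twist 𝒢 (sectionUnit σ : 𝓐) γ) := by
  set τ := sectionUnit σ with hτ
  have ha := comp_logDeriv (substHom τ) pdz (gammaT 𝒢 γ)
  have hb := comp_logDeriv (substHom τ) tpdt (gammaT 𝒢 γ)
  have hm := toConv_comp_convMul_of_linear_right (d := mulDlog τ)
    (fun a b => by simp only [mulDlog, LinearMap.mulLeft_apply]; ring)
    (inv (twist 𝒢 (τ : 𝓐) γ)) (twist 𝒢 (τ : 𝓐) γ ∘ₗ degreeOp 𝒢)
  simp only [toLinearMap_substHom, subst_gammaT, subst_tpdt_gammaT] at ha hb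
  have hd : ddz ∘ₗ twist 𝒢 (τ : 𝓐) γ = subst τ ∘ₗ pdz ∘ₗ gammaT 𝒢 γ +
      mulDlog τ ∘ₗ twist 𝒢 (τ : 𝓐) γ ∘ₗ degreeOp 𝒢 := by
    refine linearMap_ext_graded 𝒢 fun n x hx => ?_
    simp only [LinearMap.add_apply, LinearMap.comp_apply, gammaT_apply _ hx, degreeOp_apply hx,
      map_smul, twist_apply _ _ hx]
    rw [pdz, termwise_C_mul_T, subst_C_mul_T, mulDlog, LinearMap.mulLeft_apply, ddz_mul]
    have h1 : ddz ((τ : 𝓐) ^ n) = n * (τ : 𝓐) ^ n * (ddz τ * ((τ⁻¹ : 𝓐ˣ) : 𝓐)) := by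
      rw [← mul_assoc, ← ddz_pow, mul_assoc, Units.mul_inv, mul_one]
    rw [h1, Algebra.smul_def, map_natCast, zpow_natCast, Units.val_pow_eq_pow_val]
    ring
  apply toConv_injective
  rw [OneForm.restrict, toConv_add, logDeriv, toConv_conv, hd, toConv_add, mul_add, ← hm]
  congr 1
  · exact congrArg toConv ha
  · exact congrArg (fun t => toConv (mulDlog τ ∘ₗ t)) hb

theorem gammaT_conv (h𝒢 : IsConnectedGrading 𝒢) (γ ψ : H →ₗ[ℂ] 𝓐) :
    gammaT 𝒢 (conv γ ψ) = conv (gammaT 𝒢 γ) (gammaT 𝒢 ψ) := by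
  have h1 := comp_convMul_of_algHom constHom γ ψ
  have h2 := h𝒢.twist_convMul (LaurentPolynomial.T 1 : 𝓑) (constHom.toLinearMap ∘ₗ γ)
    (constHom.toLinearMap ∘ₗ ψ)
  rw [← h1] at h2
  exact congrArg ofConv h2

theorem pullback_convHom (h𝒢 : IsConnectedGrading 𝒢) (γ ψ : H →ₐ[ℂ] 𝓐) :
    pullback 𝒢 (convHom γ ψ).toLinearMap =
      gauge (gammaTHom 𝒢 ψ).toLinearMap (pullback 𝒢 γ.toLinearMap) := by
  rw [toLinearMap_convHom, pullback, gammaT_conv h𝒢]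
  exact OneForm.ext (logDeriv_conv pdz_mul (gammaTHom 𝒢 γ) (gammaTHom 𝒢 ψ))
    (logDeriv_conv tpdt_mul (gammaTHom 𝒢 γ) (gammaTHom 𝒢 ψ))

theorem rescale_comp_gammaT (u : ℂˣ) (γ : H →ₗ[ℂ] 𝓐) :
    rescale u ∘ₗ gammaT 𝒢 γ = twist 𝒢 (algebraMap ℂ 𝓑 u) (gammaT 𝒢 γ) :=
  linearMap_ext_graded 𝒢 fun n x hx => by
    rw [LinearMap.comp_apply, twist_apply _ _ hx, gammaT_apply _ hx, rescale_C_mul_T, ← map_pow]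
    simp

theorem rescale_comp_logDeriv (h𝒢 : IsConnectedGrading 𝒢) (u : ℂˣ) {d : 𝓑 →ₗ[ℂ] 𝓑}
    (hd : rescale u ∘ₗ d = d ∘ₗ rescale u) (γ : H →ₐ[ℂ] 𝓐) :
    rescale u ∘ₗ logDeriv d (gammaT 𝒢 γ.toLinearMap) =
      twist 𝒢 (algebraMap ℂ 𝓑 u) (logDeriv d (gammaT 𝒢 γ.toLinearMap)) := by
  have h1 := comp_logDeriv (rescaleHom u) d (gammaT 𝒢 γ.toLinearMap)
  have h2 : (rescaleHom u).toLinearMap = rescale u := rfl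
  have h3 : twist 𝒢 (algebraMap ℂ 𝓑 u) (d ∘ₗ gammaT 𝒢 γ.toLinearMap) =
      d ∘ₗ twist 𝒢 (algebraMap ℂ 𝓑 u) (gammaT 𝒢 γ.toLinearMap) :=
    linearMap_ext_graded 𝒢 fun n x hx => by
      rw [LinearMap.comp_apply, twist_apply _ _ hx, twist_apply _ _ hx, ← map_pow,
        ← Algebra.smul_def, ← Algebra.smul_def, map_smul, LinearMap.comp_apply]
  rw [h2, ← LinearMap.comp_assoc, hd, LinearMap.comp_assoc, rescale_comp_gammaT, ← h3,
    ← toLinearMap_gammaTHom, ← h𝒢.twist_inv] at h1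
  rw [← toLinearMap_gammaTHom, h1]
  exact (congrArg ofConv (h𝒢.twist_convMul _ _ _)).symm

end Connection

/-! ### Infinitesimal characters -/

section Infinitesimal
variable {H : Type*} [CommRing H] [HopfAlgebra ℂ H] {S : Type*} [CommRing S] [Algebra ℂ S]

/-- The map `x ⊗ y ↦ B x * ε y + ε x * B y`. -/
def leibnizSq (B : WithConv (H →ₗ[ℂ] S)) : WithConv (H ⊗[ℂ] H →ₗ[ℂ] S) :=
  toConv (LinearMap.mul' ℂ S ∘ₗ map B.ofConv (1 : WithConv (H →ₗ[ℂ] S)).ofConv) +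
    toConv (LinearMap.mul' ℂ S ∘ₗ map (1 : WithConv (H →ₗ[ℂ] S)).ofConv B.ofConv)

theorem isInfinitesimalCharacter_iff {B : H →ₗ[ℂ] S} :
    IsInfinitesimalCharacter B ↔ compMul (toConv B) = leibnizSq (toConv B) := by
  constructor
  · intro h
    apply WithConv.ext
    ext x y
    simp [compMul, leibnizSq, h x y]
  · intro h x y
    have := congrArg (fun F : WithConv (H ⊗[ℂ] H →ₗ[ℂ] S) => F (x ⊗ₜ y)) h
    simpa [compMul, leibnizSq] using this

/-- The adjoint action preserves infinitesimal characters. -/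
theorem IsInfinitesimalCharacter.ad {α : H →ₗ[ℂ] S} (hα : IsInfinitesimalCharacter α)
    (g : H →ₐ[ℂ] S) :
    IsInfinitesimalCharacter (conv g.toLinearMap (conv α (inv g.toLinearMap))) := by
  rw [isInfinitesimalCharacter_iff] at hα ⊢
  set G := toConv g.toLinearMap with hG
  have h1 : G * toConv (inv g.toLinearMap) = G * 1 * toConv (inv g.toLinearMap) := by rw [mul_one]
  have h2 : toConv (conv g.toLinearMap (conv α (inv g.toLinearMap))) =
      G * toConv α * toConv (inv g.toLinearMap) := by
    rw [toConv_conv, toConv_conv, mul_assoc]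
  have h3 : (1 : WithConv (H →ₗ[ℂ] S)) = G * 1 * toConv (inv g.toLinearMap) := by
    rw [mul_one, toConv_mul_inv]
  have h4 : leibnizSq (G * toConv α * toConv (inv g.toLinearMap)) =
      tensorSq G * leibnizSq (toConv α) * tensorSq (toConv (inv g.toLinearMap)) := by
    conv_lhs => rw [leibnizSq]; rw [h3]
    rw [mul'_map_convMul, mul'_map_convMul, mul'_map_convMul, mul'_map_convMul, ← add_mul,
      ← mul_add]
    rfl
  rw [h2, h4, compMul_mul, compMul_mul, hα, hG, tensorSq_toLinearMap, ← toLinearMap_invHom,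
    tensorSq_toLinearMap]

variable {𝒢 : ℕ → Submodule ℂ H} [GradedAlgebra 𝒢]

/-- The logarithmic derivative of a character along the grading is an infinitesimal character. -/
theorem isInfinitesimalCharacter_inv_conv_degreeOp (g : H →ₐ[ℂ] S) :
    IsInfinitesimalCharacter (conv (inv g.toLinearMap) (g.toLinearMap ∘ₗ degreeOp 𝒢)) := by
  rw [isInfinitesimalCharacter_iff]
  set G := toConv g.toLinearMap with hG
  set B := toConv (conv (inv g.toLinearMap) (g.toLinearMap ∘ₗ degreeOp 𝒢)) with hB
  have hGB : G * B = toConv (g.toLinearMap ∘ₗ degreeOp 𝒢) := by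
    rw [hB, toConv_conv, ← mul_assoc, toConv_mul_inv, one_mul]
  have h1 : compMul G * compMul B = compMul G * leibnizSq B := by
    rw [← compMul_mul, hGB, hG, ← tensorSq_toLinearMap, ← hG, leibnizSq, mul_add]
    rw [show tensorSq G = toConv (LinearMap.mul' ℂ S ∘ₗ map G.ofConv G.ofConv) from rfl,
      ← mul'_map_convMul, ← mul'_map_convMul, mul_one, hGB]
    apply WithConv.ext
    ext x y
    simp [compMul, degreeOp_mul, hG]
  have h2 := congrArg (compMul (toConv (inv g.toLinearMap)) * ·) h1
  have h3 : compMul (toConv (inv g.toLinearMap)) * compMul G = 1 := by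
    rw [← compMul_mul, toConv_inv_mul, compMul_one]
  simpa only [← mul_assoc, h3, one_mul] using h2

end Infinitesimal

/-! ### The flow `γ⁻¹ ⋆ τ ^ Y γ` -/

section Flow
variable {H : Type*} [CommRing H] [HopfAlgebra ℂ H]

theorem zpow_mul_convMul_mem {f g : WithConv (H →ₗ[ℂ] 𝓐)} {j k : ℤ}
    (hf : ∀ x, IsRegular (zpow j * f x)) (hg : ∀ x, IsRegular (zpow k * g x)) (x : H) :
    IsRegular (zpow (j + k) * (f * g) x) := by
  rw [(Coalgebra.Repr.arbitrary ℂ x).convMul_apply, Finset.mul_sum]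
  refine regularSeries.sum_mem fun i _ => ?_
  rw [← zpow_mul_zpow, mul_mul_mul_comm]
  exact regularSeries.mul_mem (hf _) (hg _)

theorem convMul_isRegular {f g : WithConv (H →ₗ[ℂ] 𝓐)}
    (hf : ∀ x, IsRegular (f x)) (hg : ∀ x, IsRegular (g x)) (x : H) : IsRegular ((f * g) x) :=
  convMul_mem (M := regularSeries.toNonUnitalSubalgebra) hf hg x

variable {𝒢 : ℕ → Submodule ℂ H} [GradedAlgebra 𝒢] (h𝒢 : IsConnectedGrading 𝒢)

theorem weight_choose_comp_degreeOp (j : ℕ) :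
    weight 𝒢 (fun n => (n.choose j : ℂ)) ∘ₗ degreeOp 𝒢 =
      ((j : ℂ) + 1) • weight 𝒢 (fun n => (n.choose (j + 1) : ℂ)) +
        (j : ℂ) • weight 𝒢 (fun n => (n.choose j : ℂ)) := by
  refine linearMap_ext_graded 𝒢 fun n x hx => ?_
  simp only [LinearMap.comp_apply, LinearMap.add_apply, LinearMap.smul_apply, degreeOp_apply hx,
    weight_apply _ hx, map_smul, smul_smul, ← add_smul]
  congr 1
  rcases lt_or_ge n j with h | h
  · simp [Nat.choose_eq_zero_of_lt h, Nat.choose_eq_zero_of_lt (h.trans (Nat.lt_succ_self j))]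
  · have h1 := congrArg (Nat.cast (R := ℂ)) (Nat.choose_succ_right_eq n j)
    push_cast [Nat.cast_sub h] at h1
    linear_combination -h1

/-- The coefficient of `(τ - 1) ^ j` in `γ⁻¹ ⋆ τ ^ Y γ`. -/
def flowCoeff (𝒢 : ℕ → Submodule ℂ H) [GradedAlgebra 𝒢] (γ : H →ₗ[ℂ] 𝓐) (j : ℕ) :
    WithConv (H →ₗ[ℂ] 𝓐) :=
  toConv (inv γ) * toConv (γ ∘ₗ weight 𝒢 fun n => (n.choose j : ℂ))

include h𝒢

/-- The recursion comes from `Y (γ ⋆ W) = γ ⋆ (b ⋆ W + Y W)`. -/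
theorem flowCoeff_succ (γ : H →ₐ[ℂ] 𝓐) (j : ℕ) :
    ((j : ℂ) + 1) • flowCoeff 𝒢 γ.toLinearMap (j + 1) =
      toConv (bComponent 𝒢 γ.toLinearMap) * flowCoeff 𝒢 γ.toLinearMap j +
        toConv ((flowCoeff 𝒢 γ.toLinearMap j).ofConv ∘ₗ degreeOp 𝒢) -
          (j : ℂ) • flowCoeff 𝒢 γ.toLinearMap j := by
  have h1 : toConv γ.toLinearMap * flowCoeff 𝒢 γ.toLinearMap j =
      toConv (γ.toLinearMap ∘ₗ weight 𝒢 fun n => (n.choose j : ℂ)) := by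
    rw [flowCoeff, ← mul_assoc, toConv_mul_inv, one_mul]
  have h2 := convMul_comp_coderivation h𝒢.comul_degreeOp (toConv γ.toLinearMap)
    (flowCoeff 𝒢 γ.toLinearMap j)
  rw [h1] at h2
  have h3 := congrArg (toConv (inv γ.toLinearMap) * ·) h2
  simp only [mul_add, ← mul_assoc, toConv_inv_mul, one_mul] at h3
  rw [bComponent_eq, toConv_conv, ← h3, LinearMap.comp_assoc, weight_choose_comp_degreeOp,
    LinearMap.comp_add, LinearMap.comp_smul, LinearMap.comp_smul, toConv_add, toConv_smul,
    toConv_smul, mul_add, mul_smul_comm, mul_smul_comm]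
  exact (add_sub_cancel_right _ _).symm

theorem isRegular_zpow_mul_flowCoeff {γ : H →ₐ[ℂ] 𝓐}
    (hb : ∀ x, IsRegular (zpow 1 * bComponent 𝒢 γ.toLinearMap x)) (j : ℕ) (x : H) :
    IsRegular (zpow j * flowCoeff 𝒢 γ.toLinearMap j x) := by
  induction j generalizing x with
  | zero =>
    have h0 : (weight 𝒢 fun n => (n.choose 0 : ℂ)) = LinearMap.id :=
      linearMap_ext_graded 𝒢 fun n x hx => by simp [weight_apply _ hx]
    have : flowCoeff 𝒢 γ.toLinearMap 0 = 1 := by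
      rw [flowCoeff, h0, LinearMap.comp_id, toConv_inv_mul]
    rw [this, Nat.cast_zero, zpow_zero, one_mul]
    exact regularSeries.algebraMap_mem _
  | succ j ih =>
    have hne : (j : ℂ) + 1 ≠ 0 := by exact_mod_cast Nat.succ_ne_zero j
    have e : flowCoeff 𝒢 γ.toLinearMap (j + 1) x = ((j : ℂ) + 1)⁻¹ •
        ((toConv (bComponent 𝒢 γ.toLinearMap) * flowCoeff 𝒢 γ.toLinearMap j) x +
          flowCoeff 𝒢 γ.toLinearMap j (degreeOp 𝒢 x) -
            (j : ℂ) • flowCoeff 𝒢 γ.toLinearMap j x) := by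
      have h := congrArg (fun F : WithConv (H →ₗ[ℂ] 𝓐) => ((j : ℂ) + 1)⁻¹ • F x)
        (flowCoeff_succ h𝒢 γ j)
      simp only [ofConv_smul, LinearMap.smul_apply, smul_smul, inv_mul_cancel₀ hne, one_smul] at h
      exact h
    have hz : ∀ y, IsRegular (zpow ((j + 1 : ℕ) : ℤ) * flowCoeff 𝒢 γ.toLinearMap j y) := fun y => by
      rw [Nat.cast_succ, add_comm, ← zpow_mul_zpow, mul_assoc, ← ofPowerSeries_X]
      exact regularSeries.mul_mem (isRegular_ofPowerSeries _) (ih y)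
    rw [e, mul_smul_comm, mul_sub, mul_add, mul_smul_comm]
    refine regularSeries.smul_mem (regularSeries.sub_mem (regularSeries.add_mem ?_ (hz _))
      (regularSeries.smul_mem (hz _) _)) _
    rw [Nat.cast_succ, add_comm]
    exact zpow_mul_convMul_mem (f := toConv (bComponent 𝒢 γ.toLinearMap)) hb ih x

theorem conv_inv_twist_eq_sum (γ : H →ₗ[ℂ] 𝓐) (v : 𝓐) {n : ℕ} {x : H} (hx : x ∈ 𝒢 n) :
    conv (inv γ) (twist 𝒢 (1 + v) γ) x =
      ∑ j ∈ Finset.range (n + 1), v ^ j * flowCoeff 𝒢 γ j x := by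
  have h := h𝒢.map_comul_eq (Φ := LinearMap.mul' ℂ 𝓐 ∘ₗ map (inv γ) (twist 𝒢 (1 + v) γ))
    (Ψ := ∑ j ∈ Finset.range (n + 1), LinearMap.mulLeft ℂ (v ^ j) ∘ₗ LinearMap.mul' ℂ 𝓐 ∘ₗ
      map (inv γ) (γ ∘ₗ weight 𝒢 fun n => (n.choose j : ℂ))) (fun p q hpq a ha b hb => ?_) hx
  · rw [LinearMap.sum_apply] at h
    exact h
  · simp only [LinearMap.sum_apply, LinearMap.comp_apply, map_tmul, LinearMap.mul'_apply,
      LinearMap.mulLeft_apply, twist_apply _ _ hb, weight_apply _ hb, map_smul]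
    rw [add_comm 1 v, add_pow, Finset.sum_mul, Finset.mul_sum]
    refine Finset.sum_subset_zero_on_sdiff (Finset.range_mono (by omega)) (fun j hj => ?_)
      (fun j hj => ?_)
    · have : q < j := by
        simp only [Finset.mem_sdiff, Finset.mem_range] at hj
        omega
      simp [Nat.choose_eq_zero_of_lt this]
    · rw [Algebra.smul_def, map_natCast]
      ring

/-- If `b(z, 1)` has at most a simple pole then `γ⁻¹ ⋆ (1 + z w) ^ Y γ` has no pole. -/
theorem isRegular_conv_inv_twist {γ : H →ₐ[ℂ] 𝓐}
    (hb : ∀ x, IsRegular (zpow 1 * bComponent 𝒢 γ.toLinearMap x)) {w : 𝓐} (hw : IsRegular w)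
    (x : H) :
    IsRegular (conv (inv γ.toLinearMap) (twist 𝒢 (1 + zpow 1 * w) γ.toLinearMap) x) := by
  have hz (j : ℕ) : zpow 1 ^ j = zpow j := by
    induction j with
    | zero => rfl
    | succ j ih => rw [pow_succ, ih, zpow_mul_zpow, Nat.cast_succ]
  induction x using DirectSum.Decomposition.inductionOn 𝒢 with
  | zero => rw [map_zero]; exact regularSeries.zero_mem
  | add a b ha hb => rw [map_add]; exact regularSeries.add_mem ha hb
  | homogeneous a =>
    rw [conv_inv_twist_eq_sum h𝒢 _ _ a.2]
    refine regularSeries.sum_mem fun j _ => ?_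
    rw [mul_pow, hz, mul_right_comm]
    exact regularSeries.mul_mem (isRegular_zpow_mul_flowCoeff h𝒢 hb j _)
      (regularSeries.pow_mem hw j)

omit h𝒢 in
theorem hasDerivAt_conv_massFlow (f g : H →ₗ[ℂ] 𝓐) (x : H) (i : ℤ) :
    HasDerivAt (fun s : ℂ => zcoeff i (conv f (massFlow 𝒢 s g) x))
      (zcoeff (i - 1) (conv f (g ∘ₗ degreeOp 𝒢) x)) 0 := by
  change HasDerivAt (fun s : ℂ => zcoeff i (LinearMap.mul' ℂ 𝓐 (map f (twist 𝒢 (expz s) g)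
    (Coalgebra.comul x)))) (zcoeff (i - 1) (LinearMap.mul' ℂ 𝓐 (map f (g ∘ₗ degreeOp 𝒢)
    (Coalgebra.comul x)))) 0
  generalize (Coalgebra.comul x : H ⊗[ℂ] H) = t
  induction t using TensorProduct.induction_on with
  | zero => simpa using hasDerivAt_const (0 : ℂ) (0 : ℂ)
  | add t t' ht ht' => simpa only [map_add] using ht.fun_add ht'
  | tmul a b =>
    simp only [map_tmul, LinearMap.mul'_apply, LinearMap.comp_apply]
    induction b using DirectSum.Decomposition.inductionOn 𝒢 with
    | zero => simpa using hasDerivAt_const (0 : ℂ) (0 : ℂ)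
    | add b b' hb hb' => simpa only [map_add, mul_add] using hb.fun_add hb'
    | @homogeneous n b =>
      have h := hasDerivAt_zcoeff_mul_expz_pow (f a * g b) n i
      simp only [twist_apply _ _ b.2, degreeOp_apply b.2, map_smul, mul_smul_comm, smul_eq_mul]
      have e (s : ℂ) : f a * (expz s ^ n * g b) = f a * g b * expz s ^ n := by ring
      simp only [e]
      exact h

theorem isBetaFunction_residue {γ : H →ₐ[ℂ] 𝓐}
    (hb : ∀ x, IsRegular (zpow 1 * bComponent 𝒢 γ.toLinearMap x)) :
    IsBetaFunction 𝒢 γ.toLinearMap (residue 𝒢 γ.toLinearMap) := by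
  refine ⟨fun s x => ?_, fun x => ?_⟩
  · obtain ⟨w, hw, h⟩ := sectionUnit_eq_mul 1 (expUnit s) (by rw [constantCoeff_expUnit]; simp)
    have h1 : expz s = 1 + zpow 1 * w := by
      have h2 : ((sectionUnit 1 : 𝓐ˣ) : 𝓐) = 1 := by simp [sectionUnit]
      rw [← sectionUnit_expUnit, h, h2, one_mul]
    rw [massFlow, h1]
    exact isRegular_conv_inv_twist h𝒢 hb hw x
  · have h := hasDerivAt_conv_massFlow (𝒢 := 𝒢) (inv γ.toLinearMap) γ.toLinearMap x 0
    rw [← bComponent_eq] at h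
    exact h

omit h𝒢 in
/-- If the flow `γ⁻¹ ⋆ t ^ (zY) γ` has no pole, then its derivative at `t = 1` has none either, so
`b(z, 1)` has at most a simple pole. -/
theorem isRegular_of_massFlow {γ : H →ₐ[ℂ] 𝓐}
    (h : ∀ (s : ℂ) (x : H), IsRegular (conv (inv γ.toLinearMap) (massFlow 𝒢 s γ.toLinearMap) x))
    (x : H) : IsRegular (zpow 1 * bComponent 𝒢 γ.toLinearMap x) := by
  intro i hi
  have h1 := hasDerivAt_conv_massFlow (𝒢 := 𝒢) (inv γ.toLinearMap) γ.toLinearMap x i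
  simp only [h _ x i hi] at h1
  rw [zcoeff_zpow_mul, bComponent_eq]
  exact h1.unique (hasDerivAt_const _ _)

omit h𝒢 in
theorem isInfinitesimalCharacter_zcoeff_comp {b : H →ₗ[ℂ] 𝓐} (hb : IsInfinitesimalCharacter b)
    (i : ℤ) : IsInfinitesimalCharacter (zcoeff i ∘ₗ b) := fun x y => by
  rw [LinearMap.comp_apply, hb x y, ← Algebra.commutes, ← Algebra.smul_def, ← Algebra.smul_def,
    map_add, map_smul, map_smul]
  simp [mul_comm]

omit h𝒢 in
theorem atMostSimplePole_iff (γ : H →ₐ[ℂ] 𝓐) :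
    AtMostSimplePole (bComponent 𝒢 γ.toLinearMap) ↔
      ∀ x, IsRegular (zpow 1 * bComponent 𝒢 γ.toLinearMap x) := by
  simp only [isRegular_zpow_one_mul]
  constructor
  · rintro ⟨α, -, h0, h⟩ x i hi
    rw [h, h0 i hi, LinearMap.zero_apply]
  · intro h
    have hinf : IsInfinitesimalCharacter (bComponent 𝒢 γ.toLinearMap) := by
      rw [bComponent_eq]; exact isInfinitesimalCharacter_inv_conv_degreeOp γ
    exact ⟨fun i => zcoeff i ∘ₗ bComponent 𝒢 γ.toLinearMap,
      fun i => isInfinitesimalCharacter_zcoeff_comp hinf i,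
      fun i hi => LinearMap.ext fun x => h x i hi, fun _ _ => rfl⟩

end Flow

/-! ### Counterterms and residues -/

section Birkhoff
variable {H : Type*} [CommRing H] [HopfAlgebra ℂ H]

theorem sub_one_mem_polar_iff {f : H →ₐ[ℂ] 𝓐} :
    (∀ x, (toConv f.toLinearMap - 1) x ∈ polarSeries) ↔
      ∀ x : H, (Coalgebra.counit x : ℂ) = 0 → IsPolar (f x) := by
  constructor
  · intro h x hx
    have := h x
    exact mem_polarSeries.mp (by simpa [hx] using this)
  · intro h x
    have := h (x - algebraMap ℂ H (Coalgebra.counit x)) (by simp)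
    rw [map_sub, AlgHom.commutes] at this
    exact this

theorem isPolar_invHom {f : H →ₐ[ℂ] 𝓐} (hf : ∀ x : H, (Coalgebra.counit x : ℂ) = 0 → IsPolar (f x))
    (x : H) (hx : (Coalgebra.counit x : ℂ) = 0) : IsPolar (invHom f x) :=
  hf _ (by simpa using hx)

/-- The value at `z = 0` of a regular character. -/
def charAtZero (f : H →ₐ[ℂ] 𝓐) (hf : ∀ x, IsRegular (f x)) : H →ₐ[ℂ] ℂ :=
  evalZero.comp (f.codRestrict regularSeries hf)

theorem zcoeff_zero_convMul {f g : H →ₗ[ℂ] 𝓐} (hf : ∀ x, IsRegular (f x))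
    (hg : ∀ x, IsRegular (g x)) :
    zcoeff 0 ∘ₗ conv f g = conv (zcoeff 0 ∘ₗ f) (zcoeff 0 ∘ₗ g) := by
  ext x
  have h1 := (Coalgebra.Repr.arbitrary ℂ x).convMul_apply (toConv f) (toConv g)
  have h2 := (Coalgebra.Repr.arbitrary ℂ x).convMul_apply (toConv (zcoeff 0 ∘ₗ f))
    (toConv (zcoeff 0 ∘ₗ g))
  refine (congrArg (zcoeff 0) h1).trans (Eq.trans ?_ h2.symm)
  rw [map_sum]
  exact Finset.sum_congr rfl fun i _ => zcoeff_zero_mul (hf _) (hg _)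

/-- Conjugation by a regular character acts on the residue of a simple pole through its value at
`z = 0`. -/
theorem zcoeff_neg_one_conj (p : H →ₐ[ℂ] 𝓐) (hp : ∀ x, IsRegular (p x)) {b : H →ₗ[ℂ] 𝓐}
    (hb : ∀ x, IsRegular (zpow 1 * b x)) :
    zcoeff (-1) ∘ₗ conv p.toLinearMap (conv b (inv p.toLinearMap)) =
      adAtZero p (zcoeff (-1) ∘ₗ b) := by
  have hz : zcoeff (-1) = zcoeff 0 ∘ₗ LinearMap.mulLeft ℂ (zpow 1) :=
    LinearMap.ext fun f => zcoeff_neg_one f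
  have h1 := toConv_comp_convMul_of_linear_right (d := LinearMap.mulLeft ℂ (zpow 1))
    (fun a b => by simp only [LinearMap.mulLeft_apply]; ring) p.toLinearMap
    (conv b (inv p.toLinearMap))
  have h2 := toConv_comp_convMul_of_linear_left (d := LinearMap.mulLeft ℂ (zpow 1))
    (fun a b => by simp only [LinearMap.mulLeft_apply]; ring) b (inv p.toLinearMap)
  have h3 : LinearMap.mulLeft ℂ (zpow 1) ∘ₗ conv p.toLinearMap (conv b (inv p.toLinearMap)) =
      conv p.toLinearMap (conv (LinearMap.mulLeft ℂ (zpow 1) ∘ₗ b) (inv p.toLinearMap)) := by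
    refine (congrArg ofConv h1).trans ?_
    exact congrArg (fun t => conv p.toLinearMap (ofConv t)) h2
  have hpinv : ∀ x, IsRegular (inv p.toLinearMap x) := fun x => hp _
  have hb' : ∀ x, IsRegular ((LinearMap.mulLeft ℂ (zpow 1) ∘ₗ b) x) := hb
  have hreg : ∀ x, IsRegular (conv (LinearMap.mulLeft ℂ (zpow 1) ∘ₗ b) (inv p.toLinearMap) x) :=
    convMul_isRegular (f := toConv _) (g := toConv _) hb' hpinv
  rw [adAtZero, hz, LinearMap.comp_assoc, h3, zcoeff_zero_convMul hp hreg,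
    zcoeff_zero_convMul hb' hpinv]
  rfl

theorem IsInfinitesimalCharacter.adAtZero {α : H →ₗ[ℂ] ℂ} (hα : IsInfinitesimalCharacter α)
    (p : H →ₐ[ℂ] 𝓐) (hp : ∀ x, IsRegular (p x)) :
    IsInfinitesimalCharacter (adAtZero p α) :=
  hα.ad (charAtZero p hp)

/-- The `𝓐`-valued linear map `β / z`. -/
def simplePole (β : H →ₗ[ℂ] ℂ) : H →ₗ[ℂ] 𝓐 :=
  LinearMap.mulLeft ℂ (zpow (-1)) ∘ₗ Algebra.linearMap ℂ 𝓐 ∘ₗ β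

theorem zcoeff_simplePole (β : H →ₗ[ℂ] ℂ) (x : H) (n : ℤ) :
    zcoeff n (simplePole β x) = if n = -1 then β x else 0 := by
  change zcoeff n (zpow (-1) * algebraMap ℂ 𝓐 (β x)) = _
  rw [zcoeff_zpow_mul, zcoeff_algebraMap]
  congr 1
  exact propext (by omega)

theorem isPolar_simplePole (β : H →ₗ[ℂ] ℂ) (x : H) : IsPolar (simplePole β x) := fun n hn => by
  rw [zcoeff_simplePole, if_neg (by omega)]

theorem IsInfinitesimalCharacter.simplePole {β : H →ₗ[ℂ] ℂ} (hβ : IsInfinitesimalCharacter β) :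
    IsInfinitesimalCharacter (simplePole β) := fun x y => by
  change zpow (-1) * algebraMap ℂ 𝓐 (β (x * y)) = zpow (-1) * algebraMap ℂ 𝓐 (β x) * _ +
    _ * (zpow (-1) * algebraMap ℂ 𝓐 (β y))
  rw [hβ x y]
  simp only [map_add, map_mul, Algebra.algebraMap_self, RingHom.id_apply]
  ring

variable {𝒢 : ℕ → Submodule ℂ H} [GradedAlgebra 𝒢] (h𝒢 : IsConnectedGrading 𝒢)

theorem IsBirkhoff.of_mul {γ γm γp : H →ₐ[ℂ] 𝓐}
    (h : toConv γm.toLinearMap * toConv γ.toLinearMap = toConv γp.toLinearMap)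
    (hm : ∀ x : H, (Coalgebra.counit x : ℂ) = 0 → IsPolar (γm x)) (hp : ∀ x, IsRegular (γp x)) :
    IsBirkhoff γ.toLinearMap γm γp where
  eq := by
    apply toConv_injective
    rw [toConv_conv, ← h, ← mul_assoc, toConv_inv_mul, one_mul]
  polar := hm
  regular := hp

theorem IsBirkhoff.toConv_eq {γ : H →ₗ[ℂ] 𝓐} {γm γp : H →ₐ[ℂ] 𝓐} (h : IsBirkhoff γ γm γp) :
    toConv γ = toConv (inv γm.toLinearMap) * toConv γp.toLinearMap := congrArg toConv h.eq

include h𝒢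

theorem exists_isBirkhoff (γ : H →ₐ[ℂ] 𝓐) :
    ∃ γm γp : H →ₐ[ℂ] 𝓐, IsBirkhoff γ.toLinearMap γm γp := by
  obtain ⟨γm, γp, h, hm, hp⟩ := h𝒢.exists_birkhoff (M := polarSeries)
    (N := regularSeries.toNonUnitalSubalgebra)
    (fun x hx hx' => eq_zero_of_isPolar_of_isRegular hx hx') polarPart isPolar_polarPart
    isRegular_sub_polarPart γ
  refine ⟨γm, γp, .of_mul h (sub_one_mem_polar_iff.mp hm) fun x => ?_⟩
  have := regularSeries.add_mem (hp x) (regularSeries.algebraMap_mem (Coalgebra.counit x : ℂ))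
  exact mem_regularSeries.mp (by simpa using this)

/-- For a simple pole, the inverse `g` of the counterterm satisfies `Y g = g ⋆ (β / z)` where `β` is
the residue transported to the counterterm: `g⁻¹ ⋆ Y g` is a pure pole because `g` is, and it is
conjugate to `b(z, 1)` up to regular terms. -/
theorem IsBirkhoff.inv_comp_degreeOp {γ γm γp : H →ₐ[ℂ] 𝓐} (h : IsBirkhoff γ.toLinearMap γm γp)
    (hb : ∀ x, IsRegular (zpow 1 * bComponent 𝒢 γ.toLinearMap x)) :
    toConv (inv γm.toLinearMap ∘ₗ degreeOp 𝒢) = toConv (inv γm.toLinearMap) *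
      toConv (simplePole (adAtZero γp (residue 𝒢 γ.toLinearMap))) := by
  set G := toConv (inv γm.toLinearMap) with hG
  set P := toConv γp.toLinearMap with hP
  set Pi := toConv (inv γp.toLinearMap) with hPi
  set Gm := toConv γm.toLinearMap with hGm
  set b := bComponent 𝒢 γ.toLinearMap with hb_def
  have hGmG : Gm * G = 1 := toConv_mul_inv γm
  have hGGm : G * Gm = 1 := toConv_inv_mul γm
  have hPPi : P * Pi = 1 := toConv_mul_inv γp
  set GY := toConv (inv γm.toLinearMap ∘ₗ degreeOp 𝒢) with hGY
  set PY := toConv (γp.toLinearMap ∘ₗ degreeOp 𝒢) with hPY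
  have hγ : toConv γ.toLinearMap = G * P := h.toConv_eq
  have hY : toConv (γ.toLinearMap ∘ₗ degreeOp 𝒢) = GY * P + G * PY := by
    have := convMul_comp_coderivation h𝒢.comul_degreeOp G P
    rw [← hγ] at this
    exact this
  have hbY : toConv γ.toLinearMap * toConv b = toConv (γ.toLinearMap ∘ₗ degreeOp 𝒢) := by
    rw [hb_def, bComponent_eq, toConv_conv, ← mul_assoc, toConv_mul_inv, one_mul]
  -- the logarithmic derivative of the counterterm, up to a regular term
  have key : Gm * GY = P * (toConv b * Pi) - PY * Pi := by
    have h1 : G * P * toConv b = GY * P + G * PY := by rw [← hγ, hbY, hY]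
    have h2 : Gm * (G * P * toConv b) * Pi = Gm * (GY * P + G * PY) * Pi := by rw [h1]
    have h3 : Gm * (G * P * toConv b) * Pi = (Gm * G) * (P * (toConv b * Pi)) := by
      simp only [mul_assoc]
    have h4 : Gm * (GY * P + G * PY) * Pi = Gm * GY * (P * Pi) + (Gm * G) * (PY * Pi) := by
      simp only [mul_assoc, mul_add, add_mul]
    rw [h3, h4, hGmG, hPPi, one_mul, one_mul, mul_one] at h2
    rw [h2, add_sub_cancel_right]
  have hpolar : ∀ x, (Gm * GY) x ∈ polarSeries := by
    have hGp : ∀ x, GY x ∈ polarSeries := fun x => by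
      refine isPolar_invHom h.polar _ ?_
      induction x using DirectSum.Decomposition.inductionOn 𝒢 with
      | zero => simp
      | add a b ha hb => rw [map_add, map_add, ha, hb, add_zero]
      | @homogeneous n a =>
        rw [degreeOp_apply a.2, map_smul]
        rcases eq_or_ne n 0 with rfl | hn
        · simp
        · rw [h𝒢.counit_eq_zero hn a.2, smul_zero]
    have e : Gm * GY = (Gm - 1) * GY + GY := by rw [sub_mul, one_mul, sub_add_cancel]
    intro x
    rw [e]
    exact polarSeries.add_mem (convMul_mem (sub_one_mem_polar_iff.mpr h.polar) hGp x) (hGp x)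
  have hPireg : ∀ x, IsRegular (Pi x) := fun x => h.regular _
  have hPYreg : ∀ x, IsRegular ((PY * Pi) x) :=
    convMul_isRegular (fun x => h.regular _) hPireg
  have hpole : ∀ x, IsRegular (zpow 1 * (P * (toConv b * Pi)) x) := by
    have h0 (f : WithConv (H →ₗ[ℂ] 𝓐)) (hf : ∀ x, IsRegular (f x)) (x : H) :
        IsRegular (zpow 0 * f x) := by rw [zpow_zero, one_mul]; exact hf x
    have h1 := zpow_mul_convMul_mem (f := toConv b) (g := Pi) hb (h0 _ hPireg)
    have h2 := zpow_mul_convMul_mem (f := P) (h0 P h.regular) h1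
    exact h2
  have hB : Gm * GY = toConv (simplePole (adAtZero γp (residue 𝒢 γ.toLinearMap))) := by
    refine WithConv.ext (LinearMap.ext fun x => ext_zcoeff fun n => ?_)
    rw [ofConv_toConv, zcoeff_simplePole]
    split_ifs with hn
    · subst hn
      have h1 := LinearMap.congr_fun (zcoeff_neg_one_conj γp h.regular hb) x
      rw [key, ofConv_sub, LinearMap.sub_apply, map_sub, hPYreg x (-1) (by norm_num), sub_zero]
      exact h1
    · rcases lt_or_ge n 0 with h0 | h0
      · rw [key, ofConv_sub, LinearMap.sub_apply, map_sub, hPYreg x n h0, sub_zero]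
        exact isRegular_zpow_one_mul.mp (hpole x) n (by omega)
      · exact hpolar x n h0
  rw [← hB, ← mul_assoc, hGGm, one_mul]

/-- The counterterm is determined by the transported residue. -/
theorem IsBirkhoff.counterterm_eq {γ γm γp γ' γ'm γ'p : H →ₐ[ℂ] 𝓐}
    (h : IsBirkhoff γ.toLinearMap γm γp) (h' : IsBirkhoff γ'.toLinearMap γ'm γ'p)
    (hb : ∀ x, IsRegular (zpow 1 * bComponent 𝒢 γ.toLinearMap x))
    (hb' : ∀ x, IsRegular (zpow 1 * bComponent 𝒢 γ'.toLinearMap x))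
    (hres : adAtZero γ'p (residue 𝒢 γ'.toLinearMap) = adAtZero γp (residue 𝒢 γ.toLinearMap)) :
    γ'm = γm := by
  have h1 := h.inv_comp_degreeOp h𝒢 hb
  have h2 := h'.inv_comp_degreeOp h𝒢 hb'
  rw [hres] at h2
  have hα : IsInfinitesimalCharacter (residue 𝒢 γ.toLinearMap) := by
    rw [residue, bComponent_eq]
    exact isInfinitesimalCharacter_zcoeff_comp (isInfinitesimalCharacter_inv_conv_degreeOp γ) _
  have hβ := (hα.adAtZero γp h.regular).simplePole
  have h3 := h𝒢.eq_of_degreeOp_eq (f := toConv (inv γ'm.toLinearMap))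
    (g := toConv (inv γm.toLinearMap)) (by simpa using hβ 1 1) (map_one (invHom γ'm))
    (map_one (invHom γm)) h2 h1
  refine AlgHom.toLinearMap_injective ?_
  rw [← inv_inv γ'm, ← inv_inv γm]
  exact congrArg (fun t => inv (ofConv t)) h3

/-- A character with logarithmic derivative `β / z` along the grading, the counterpart of the
scattering formula, is its own polar part. -/
theorem exists_hom_simplePole {β : H →ₗ[ℂ] ℂ} (hβ : IsInfinitesimalCharacter β) :
    ∃ g : H →ₐ[ℂ] 𝓐, bComponent 𝒢 g.toLinearMap = simplePole β ∧
      IsBirkhoff g.toLinearMap (invHom g) (1 : WithConv (H →ₐ[ℂ] 𝓐)).ofConv := by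
  obtain ⟨g, hg⟩ := h𝒢.exists_hom_degreeOp_eq hβ.simplePole
  have hpol : ∀ n, n ≠ 0 → ∀ x ∈ 𝒢 n, g x ∈ polarSeries.toSubmodule := by
    intro n
    induction n using Nat.strong_induction_on with
    | _ n ih =>
      intro hn x hx
      have h1 : (toConv g.toLinearMap * toConv (simplePole β)) x ∈ polarSeries.toSubmodule := by
        refine h𝒢.convMul_apply_mem (fun p q hpq a ha b hb => ?_) hx
        rcases eq_or_ne p 0 with rfl | hp
        · have h2 : g a = algebraMap ℂ 𝓐 (Coalgebra.counit a) := by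
            conv_lhs => rw [h𝒢.eq_algebraMap_counit ha]
            exact AlgHom.commutes g _
          change g a * simplePole β b ∈ _
          rw [h2, ← Algebra.smul_def]
          exact Submodule.smul_mem _ _ (isPolar_simplePole β b)
        · rcases eq_or_ne q 0 with rfl | hq
          · have h3 : simplePole β b = 0 := by
              have h4 : simplePole β 1 = 0 := by simpa using hβ.simplePole 1 1
              rw [h𝒢.eq_algebraMap_counit hb, Algebra.algebraMap_eq_smul_one, map_smul, h4,
                smul_zero]
            change g a * simplePole β b ∈ _
            rw [h3, mul_zero]
            exact zero_mem _
          · exact polarSeries.mul_mem (ih p (by omega) hp a ha) (isPolar_simplePole β b)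
      rw [← hg] at h1
      change g (degreeOp 𝒢 x) ∈ _ at h1
      rw [degreeOp_apply hx, map_smul] at h1
      exact (Submodule.smul_mem_iff _ (Nat.cast_ne_zero.mpr hn : (n : ℂ) ≠ 0)).mp h1
  have hpol' : ∀ x : H, (Coalgebra.counit x : ℂ) = 0 → IsPolar (g x) := by
    refine sub_one_mem_polar_iff.mp fun x => ?_
    induction x using DirectSum.Decomposition.inductionOn 𝒢 with
    | zero => rw [map_zero]; exact polarSeries.zero_mem
    | add a b ha hb => rw [map_add]; exact polarSeries.add_mem ha hb
    | @homogeneous n a =>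
      rcases eq_or_ne n 0 with rfl | hn
      · rw [h𝒢.sub_one_apply_of_mem_zero (map_one g) a.2]; exact polarSeries.zero_mem
      · rw [ofConv_sub, LinearMap.sub_apply, h𝒢.one_apply_of_ne hn a.2, sub_zero]
        exact hpol n hn a a.2
  refine ⟨g, ?_, .of_mul (toConv_inv_mul g) (isPolar_invHom hpol') fun x =>
    regularSeries.algebraMap_mem _⟩
  rw [bComponent_eq]
  apply toConv_injective
  rw [toConv_conv, hg, ← mul_assoc, toConv_inv_mul, one_mul]

end Birkhoff

/-! ### The equivalences -/

section Equivalences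
variable {H : Type*} [CommRing H] [HopfAlgebra ℂ H] {𝒢 : ℕ → Submodule ℂ H} [GradedAlgebra 𝒢]

/-- The section `t = exp (s z)` has the value `1` at `z = 0`, as the section `t = 1` has. -/
theorem IsEquisingular.exists_massFlow_eq {γ : H →ₐ[ℂ] 𝓐}
    (h : IsEquisingular 𝒢 γ.toLinearMap) (s : ℂ) :
    ∃ ψ : H →ₐ[ℂ] 𝓐, (∀ x, IsRegular (ψ x)) ∧
      massFlow 𝒢 s γ.toLinearMap = conv γ.toLinearMap ψ.toLinearMap := by
  obtain ⟨ψ, hψ, h1, -⟩ := h.2 1 (expUnit s) (by rw [constantCoeff_expUnit]; simp)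
  refine ⟨ψ, hψ, ?_⟩
  rwa [subst_gammaT, subst_gammaT, show ((sectionUnit 1 : 𝓐ˣ) : 𝓐) = 1 by simp [sectionUnit],
    twist_one_left, sectionUnit_expUnit] at h1

theorem IsEquisingular.countertermIndependent (h𝒢 : IsConnectedGrading 𝒢) {γ : H →ₐ[ℂ] 𝓐}
    (h : IsEquisingular 𝒢 γ.toLinearMap) : CountertermIndependent 𝒢 γ.toLinearMap := by
  obtain ⟨γm, γp, hγ⟩ := exists_isBirkhoff h𝒢 γ
  refine ⟨γm, fun s => ?_⟩
  obtain ⟨ψ, hψ, hs⟩ := h.exists_massFlow_eq s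
  refine ⟨convHom γp ψ, ?_, hγ.polar, convMul_isRegular (f := toConv γp.toLinearMap)
    (g := toConv ψ.toLinearMap) hγ.regular hψ⟩
  apply toConv_injective
  rw [hs, toConv_conv, hγ.toConv_eq, toConv_conv, toLinearMap_convHom, toConv_conv, mul_assoc]

theorem CountertermIndependent.isRegular {γ : H →ₐ[ℂ] 𝓐}
    (h : CountertermIndependent 𝒢 γ.toLinearMap) (x : H) :
    IsRegular (zpow 1 * bComponent 𝒢 γ.toLinearMap x) := by
  obtain ⟨γm, h⟩ := h
  refine isRegular_of_massFlow (fun s => ?_) x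
  obtain ⟨γ₀, h₀⟩ := h 0
  obtain ⟨γs, hs⟩ := h s
  rw [massFlow, expz_zero, twist_one_left] at h₀
  have h1 : toConv (inv γ.toLinearMap) = toConv (inv γ₀.toLinearMap) * toConv γm.toLinearMap := by
    refine left_inv_eq_right_inv (toConv_inv_mul γ) ?_
    rw [h₀.toConv_eq, mul_assoc, ← mul_assoc (toConv γ₀.toLinearMap), toConv_mul_inv, one_mul,
      toConv_inv_mul]
  have h2 : toConv (conv (inv γ.toLinearMap) (massFlow 𝒢 s γ.toLinearMap)) =
      toConv (inv γ₀.toLinearMap) * toConv γs.toLinearMap := by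
    rw [toConv_conv, h1, hs.toConv_eq, mul_assoc, ← mul_assoc (toConv γm.toLinearMap),
      toConv_mul_inv, one_mul]
  intro y
  have h3 := convMul_isRegular (f := toConv (inv γ₀.toLinearMap)) (g := toConv γs.toLinearMap)
    (fun _ => h₀.regular _) hs.regular y
  rw [← h2] at h3
  exact h3

/-- The gauge transformation between the restrictions to `σ` and `σ' = σ (1 + z w)` is
`σ ^ Y (γ⁻¹ ⋆ (1 + z w) ^ Y γ)`. -/
theorem isEquisingular_of_isRegular (h𝒢 : IsConnectedGrading 𝒢) {γ : H →ₐ[ℂ] 𝓐}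
    (hb : ∀ x, IsRegular (zpow 1 * bComponent 𝒢 γ.toLinearMap x)) :
    IsEquisingular 𝒢 γ.toLinearMap := by
  refine ⟨fun u => ⟨rescale_comp_logDeriv h𝒢 u (rescale_comp_pdz u) γ,
    rescale_comp_logDeriv h𝒢 u (rescale_comp_tpdt u) γ⟩, fun σ σ' hσ => ?_⟩
  obtain ⟨w, hw, hσ'⟩ := sectionUnit_eq_mul σ σ' hσ
  have hτreg : IsRegular (sectionUnit σ : 𝓐) := isRegular_ofPowerSeries _
  generalize hτ : (sectionUnit σ : 𝓐) = τ at hτreg hσ'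
  let U := convHom (invHom γ) (twistHom 𝒢 (1 + zpow 1 * w) γ)
  have hU : ∀ x, IsRegular (U x) := isRegular_conv_inv_twist h𝒢 hb hw
  let ψ := twistHom 𝒢 τ U
  have hψ : ∀ x, IsRegular (ψ x) := twist_mem (M := Subalgebra.toSubmodule regularSeries)
    fun n x => regularSeries.mul_mem (regularSeries.pow_mem hτreg n) (hU x)
  have hγU : toConv γ.toLinearMap * toConv U.toLinearMap =
      toConv (twist 𝒢 (1 + zpow 1 * w) γ.toLinearMap) := by
    rw [toLinearMap_convHom, toConv_conv, ← mul_assoc, toLinearMap_invHom, toConv_mul_inv, one_mul,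
      toLinearMap_twistHom]
  have hsec : twist 𝒢 (sectionUnit σ' : 𝓐) γ.toLinearMap =
      conv (twistHom 𝒢 τ γ).toLinearMap ψ.toLinearMap := by
    rw [hσ', ← twist_twist]
    have h := h𝒢.twist_convMul τ γ.toLinearMap U.toLinearMap
    rw [hγU] at h
    exact congrArg ofConv h
  refine ⟨ψ, hψ, ?_, ?_⟩
  · rw [subst_gammaT, subst_gammaT, hτ]
    exact hsec
  · rw [restrict_pullback, restrict_pullback, hτ, hsec, logDeriv_conv ddz_mul]
    rfl

theorem pullbackEquiv_convHom (h𝒢 : IsConnectedGrading 𝒢) (γ : H →ₐ[ℂ] 𝓐) {ψ : H →ₐ[ℂ] 𝓐}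
    (hψ : ∀ x, IsRegular (ψ x)) :
    PullbackEquiv 𝒢 γ.toLinearMap (convHom γ ψ).toLinearMap := by
  refine ⟨gammaTHom 𝒢 ψ, fun x => ?_, pullback_convHom h𝒢 γ ψ⟩
  rw [gammaTHom_apply]
  exact mem_regularB.mp (gammaT_mem_regularB (γ := ψ.toLinearMap) hψ x)

/-- Two characters with the same counterterm differ by a regular character. -/
theorem IsBirkhoff.exists_eq_convHom {γ γ' γm γp γ'p : H →ₐ[ℂ] 𝓐}
    (hγ : IsBirkhoff γ.toLinearMap γm γp) (hγ' : IsBirkhoff γ'.toLinearMap γm γ'p) :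
    ∃ ψ : H →ₐ[ℂ] 𝓐, (∀ x, IsRegular (ψ x)) ∧ γ' = convHom γ ψ := by
  refine ⟨convHom (invHom γp) γ'p, convMul_isRegular (f := toConv (inv γp.toLinearMap))
    (g := toConv γ'p.toLinearMap) (fun _ => hγ.regular _) hγ'.regular, ?_⟩
  apply AlgHom.toLinearMap_injective
  apply toConv_injective
  rw [toLinearMap_convHom, toConv_conv, toLinearMap_convHom, toConv_conv, hγ.toConv_eq,
    hγ'.toConv_eq, mul_assoc, ← mul_assoc (toConv γp.toLinearMap), toLinearMap_invHom,
    toConv_mul_inv, one_mul]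

theorem residueDetermines_of_isRegular (h𝒢 : IsConnectedGrading 𝒢) {γ : H →ₐ[ℂ] 𝓐}
    (hb : ∀ x, IsRegular (zpow 1 * bComponent 𝒢 γ.toLinearMap x)) :
    ResidueDetermines 𝒢 γ.toLinearMap := by
  obtain ⟨γm, γp, hγ⟩ := exists_isBirkhoff h𝒢 γ
  refine ⟨γm, γp, hγ, fun γ' γ'm γ'p hγ' hb' hres => ?_⟩
  obtain rfl := hγ.counterterm_eq h𝒢 hγ' hb ((atMostSimplePole_iff γ').mp hb') hres
  obtain ⟨ψ, hψ, rfl⟩ := hγ.exists_eq_convHom hγ'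
  exact pullbackEquiv_convHom h𝒢 γ hψ

/-- A regular gauge transformation does not change the order of the pole of `b(z, 1)`. -/
theorem PullbackEquiv.isRegular {γ γ' : H →ₗ[ℂ] 𝓐} (h : PullbackEquiv 𝒢 γ γ')
    (hb : ∀ x, IsRegular (zpow 1 * bComponent 𝒢 γ' x)) (x : H) :
    IsRegular (zpow 1 * bComponent 𝒢 γ x) := by
  obtain ⟨ψ, hψ, h⟩ := h
  let ψ₁ := (substHom 1).comp ψ
  have hψ₁ : ∀ x, IsRegular (ψ₁ x) := fun x => isRegular_subst_one (hψ x)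
  have hψ₁' : ∀ x, IsRegular (invHom ψ₁ x) := fun x => hψ₁ _
  set L := conv (inv ψ₁.toLinearMap) (subst 1 ∘ₗ tpdt ∘ₗ ψ.toLinearMap) with hL
  have hLreg : ∀ x, IsRegular (L x) := convMul_isRegular (f := toConv (inv ψ₁.toLinearMap))
    (g := toConv (subst 1 ∘ₗ tpdt ∘ₗ ψ.toLinearMap)) hψ₁'
    fun x => isRegular_subst_one (tpdt_mem_regularB (hψ x))
  have h1 : bComponent 𝒢 γ' = L + conjBy ψ₁.toLinearMap (bComponent 𝒢 γ) := by
    rw [bComponent, h]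
    change subst 1 ∘ₗ (logDeriv tpdt ψ.toLinearMap + conjBy ψ.toLinearMap (pullback 𝒢 γ).b) = _
    rw [LinearMap.comp_add]
    congr 1
    · exact comp_logDeriv (substHom 1) tpdt ψ.toLinearMap
    · have h2 := comp_convMul_of_algHom (substHom 1) (inv ψ.toLinearMap)
        (conv (pullback 𝒢 γ).b ψ.toLinearMap)
      have h3 := comp_convMul_of_algHom (substHom 1) (pullback 𝒢 γ).b ψ.toLinearMap
      refine h2.trans ?_
      exact congrArg (fun t => conv (inv ψ₁.toLinearMap) t) h3
  have h2 : toConv (bComponent 𝒢 γ) = toConv ψ₁.toLinearMap *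
      (toConv (bComponent 𝒢 γ' - L) * toConv (inv ψ₁.toLinearMap)) := by
    rw [h1, add_sub_cancel_left, conjBy, toConv_conv, toConv_conv]
    rw [mul_assoc, mul_assoc, toConv_mul_inv, mul_one, ← mul_assoc, toConv_mul_inv, one_mul]
  have h0 (f : WithConv (H →ₗ[ℂ] 𝓐)) (hf : ∀ x, IsRegular (f x)) (x : H) :
      IsRegular (zpow 0 * f x) := by rw [zpow_zero, one_mul]; exact hf x
  have hz : IsRegular (zpow 1) := by rw [← ofPowerSeries_X]; exact isRegular_ofPowerSeries _
  have h3 : ∀ x, IsRegular (zpow 1 * toConv (bComponent 𝒢 γ' - L) x) := fun x => by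
    rw [toConv_sub, ofConv_sub, LinearMap.sub_apply, mul_sub]
    exact regularSeries.sub_mem (hb x) (regularSeries.mul_mem hz (hLreg x))
  have h4 := zpow_mul_convMul_mem (h0 (toConv ψ₁.toLinearMap) hψ₁)
    (zpow_mul_convMul_mem h3 (h0 (toConv (inv ψ₁.toLinearMap)) hψ₁')) x
  rw [← h2] at h4
  exact h4

theorem adAtZero_one (β : H →ₗ[ℂ] ℂ) :
    adAtZero (1 : WithConv (H →ₐ[ℂ] 𝓐)).ofConv β = β := by
  have h1 : zcoeff 0 ∘ₗ (1 : WithConv (H →ₐ[ℂ] 𝓐)).ofConv.toLinearMap =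
      (1 : WithConv (H →ₐ[ℂ] ℂ)).ofConv.toLinearMap :=
    LinearMap.ext fun x => by
      change zcoeff 0 (algebraMap ℂ 𝓐 (Coalgebra.counit x)) = _
      rw [zcoeff_algebraMap, if_pos rfl]
      rfl
  have h2 : toConv (1 : WithConv (H →ₐ[ℂ] ℂ)).ofConv.toLinearMap = 1 :=
    AlgHom.toLinearMap_convOne
  have h3 := toConv_mul_inv (1 : WithConv (H →ₐ[ℂ] ℂ)).ofConv
  rw [h2, one_mul] at h3
  rw [adAtZero, h1]
  apply toConv_injective
  rw [toConv_conv, toConv_conv, h2, h3, one_mul, mul_one]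

/-- The pullback is compared with that of the character `g` with `g⁻¹ ⋆ Y g = β / z`, where `β` is
the transported residue of `γ`. -/
theorem ResidueDetermines.isRegular (h𝒢 : IsConnectedGrading 𝒢) {γ : H →ₐ[ℂ] 𝓐}
    (h : ResidueDetermines 𝒢 γ.toLinearMap) (x : H) :
    IsRegular (zpow 1 * bComponent 𝒢 γ.toLinearMap x) := by
  obtain ⟨γm, γp, hγ, h⟩ := h
  have hα : IsInfinitesimalCharacter (residue 𝒢 γ.toLinearMap) := by
    rw [residue, bComponent_eq]
    exact isInfinitesimalCharacter_zcoeff_comp (isInfinitesimalCharacter_inv_conv_degreeOp γ) _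
  set β := adAtZero γp (residue 𝒢 γ.toLinearMap) with hβ
  obtain ⟨g, hg, hgB⟩ := exists_hom_simplePole h𝒢 (hα.adAtZero γp hγ.regular)
  have hreg : ∀ x, IsRegular (zpow 1 * bComponent 𝒢 g.toLinearMap x) := fun x => by
    rw [isRegular_zpow_one_mul, hg]
    intro i hi
    rw [zcoeff_simplePole, if_neg (by omega)]
  have hres : residue 𝒢 g.toLinearMap = β := LinearMap.ext fun x => by
    rw [residue, hg, LinearMap.comp_apply, zcoeff_simplePole, if_pos rfl]
  exact (h g _ _ hgB ((atMostSimplePole_iff g).mpr hreg) (by rw [adAtZero_one, hres])).isRegular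
    hreg x

/-- The inverse of the counterterm has `b(z, 1) = β / z`, so its residue is `β`. -/
theorem isBetaFunction_counterterm (h𝒢 : IsConnectedGrading 𝒢) {γ γm γp : H →ₐ[ℂ] 𝓐}
    (hγ : IsBirkhoff γ.toLinearMap γm γp)
    (hb : ∀ x, IsRegular (zpow 1 * bComponent 𝒢 γ.toLinearMap x)) :
    IsBetaFunction 𝒢 (inv γm.toLinearMap) (adAtZero γp (residue 𝒢 γ.toLinearMap)) := by
  set β := adAtZero γp (residue 𝒢 γ.toLinearMap) with hβ
  have h1 : bComponent 𝒢 (invHom γm).toLinearMap = simplePole β := by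
    rw [bComponent_eq]
    apply toConv_injective
    rw [toConv_conv, toLinearMap_invHom, hγ.inv_comp_degreeOp h𝒢 hb, ← mul_assoc,
      ← toLinearMap_invHom, toConv_inv_mul, one_mul]
  have hreg : ∀ x, IsRegular (zpow 1 * bComponent 𝒢 (invHom γm).toLinearMap x) := fun x => by
    rw [isRegular_zpow_one_mul, h1]
    intro i hi
    rw [zcoeff_simplePole, if_neg (by omega)]
  have hres : residue 𝒢 (invHom γm).toLinearMap = β := LinearMap.ext fun x => by
    rw [residue, h1, LinearMap.comp_apply, zcoeff_simplePole, if_pos rfl]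
  have h2 := isBetaFunction_residue h𝒢 hreg
  rw [hres] at h2
  exact h2

end Equivalences

end Renorm

end

theorem mainTheorem3 {H : Type*} [CommRing H] [HopfAlgebra ℂ H]
    (𝒢 : ℕ → Submodule ℂ H) [GradedAlgebra 𝒢] (h𝒢 : Renorm.IsConnectedGrading 𝒢)
    (γ : H →ₐ[ℂ] Renorm.𝓐) :
    List.TFAE
      [Renorm.IsEquisingular 𝒢 γ.toLinearMap,
        Renorm.CountertermIndependent 𝒢 γ.toLinearMap,
        Renorm.AtMostSimplePole (Renorm.bComponent 𝒢 γ.toLinearMap),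
        Renorm.ResidueDetermines 𝒢 γ.toLinearMap] ∧
    (Renorm.AtMostSimplePole (Renorm.bComponent 𝒢 γ.toLinearMap) →
      Renorm.IsBetaFunction 𝒢 γ.toLinearMap (Renorm.residue 𝒢 γ.toLinearMap) ∧
      ∀ γm γp : H →ₐ[ℂ] Renorm.𝓐, Renorm.IsBirkhoff γ.toLinearMap γm γp →
        Renorm.IsBetaFunction 𝒢 (Renorm.inv γm.toLinearMap)
          (Renorm.adAtZero γp (Renorm.residue 𝒢 γ.toLinearMap))) := by
  rw [Renorm.atMostSimplePole_iff γ]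
  refine ⟨?_, fun hb => ⟨Renorm.isBetaFunction_residue h𝒢 hb,
    fun γm γp hγ => Renorm.isBetaFunction_counterterm h𝒢 hγ hb⟩⟩
  tfae_have 1 → 2 := Renorm.IsEquisingular.countertermIndependent h𝒢
  tfae_have 2 → 3 := Renorm.CountertermIndependent.isRegular
  tfae_have 3 → 1 := Renorm.isEquisingular_of_isRegular h𝒢
  tfae_have 3 → 4 := Renorm.residueDetermines_of_isRegular h𝒢
  tfae_have 4 → 3 := Renorm.ResidueDetermines.isRegular h𝒢
  tfae_finish
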